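/- **Setting.** All sequences are indexed by the positive integers. For $0<\varepsilon<1$ one observes $Y=(Y_j)_{j\ge1}$ with $Y_j=\lambda_j\theta_j+\sqrt{\varepsilon}\,\xi_j$, where the $\xi_j$ are i.i.d. standard normal and $\lambda=(\lambda_j)_{j\ge 1}$ is a sequence of nonzero reals; $\mathbb E_{\theta}$ denotes expectation when the parameter is $\theta$. Put $\Lambda_j=\lambda_j^{-2}$, $\Lambda_{(m)}=\max_{1\le j\le m}\Lambda_j$, $\overline\Lambda_m=m^{-1}\sum_{j=1}^m\Lambda_j$ and $G_\varepsilon=\max\{1\le m\le\lfloor\varepsilon^{-1}\rfloor:\varepsilon\Lambda_{(m)}\le\Lambda_1\}$. Let $\mu=(\mu_j)$ be prior means, $\varsigma=(\varsigma_j)$ prior variances, and $\sigma_j=(\lambda_j^2\varepsilon^{-1}+\varsigma_j^{-1})^{-1}$. Let $\gamma=(\gamma_j)$ be strictly positive and non-increasing with $\gamma_1=1$ and $\gamma_j\to0$, put $\|\theta\|_\gamma^2=\sum_j\theta_j^2/\gamma_j$ and $\|\theta\|^2=\sum_j\theta_j^2$, and for $r\ge0$ let $F_\gamma^r=\{\theta:\|\theta\|_\gamma<\infty,\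 \|\theta-\mu\|_\gamma^2\le r\}$ (the ellipsoid), assumed non-empty. Let $m^\star_\varepsilon$ be the smallest minimiser over $m\ge1$ of $\gamma_m\vee\varepsilon m\overline\Lambda_m$, and let $r^\star_\varepsilon=\gamma_{m^\star_\varepsilon}\vee\varepsilon m^\star_\varepsilon\overline\Lambda_{m^\star_\varepsilon}$ be the minimal value (the minimax rate). **Assumptions.** There are constants $d>0$, $C\ge1$, $L\ge1$, $\varepsilon_o>0$ such that: 1. $\varsigma_j\ge d\,[\varepsilon^{1/2}\Lambda_j^{1/2}\vee\varepsilon\Lambda_j]$ for all $1\le j\le G_\varepsilon$ and all $\varepsilon\in(0,1)$; 2. $\kappa^\star:=\inf_{0<\varepsilon<\varepsilon_o}(r^\star_\varepsilon)^{-1}[\gamma_{m^\star_\varepsilon}\wedge\varepsilon m^\star_\varepsilon\overline\Lambda_{m^\star_\varepsilon}]>0$; 3. for all $k,l\ge1$: $\sup_{j>k}\lambda_j^2\le C\min_{1\le j\le k}\lambda_j^2$, $\ \Lambda_{(kl)}\le\Lambda_{(k)}\Lambda_{(l)}$, and $1\le\Lambda_{(k)}/\overline\Lambda_k\le L$; 4.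 $(\log G_\varepsilon)/m^\star_\varepsilon\to0$ as $\varepsilon\to0$. **Hierarchical prior.** $M$ takes values in $\{1,\dots,G_\varepsilon\}$ with $P(M=m)$ proportional to $\exp(-3Cm/2)\prod_{j=1}^m(\varsigma_j/\sigma_j)^{1/2}$. Given $M=m$, the coordinates of $\vartheta^M$ are independent, $\vartheta^M_j\sim N(\mu_j,\varsigma_j)$ for $j\le m$ and $\vartheta^M_j=\mu_j$ for $j>m$. Let $P_{\vartheta^M|Y}$ be the posterior distribution of $\vartheta^M$, i.e. the conditional distribution of $\vartheta^M$ given $Y$ when $Y_j=\lambda_j\vartheta^M_j+\sqrt\varepsilon\,\xi_j$ with $\xi$ independent of $\vartheta^M$. **Theorem.** Put $D^\star=\lceil5L/\kappa^\star\rceil$ and $$K^\star=16\big((1+1/d)\vee r/d^2\big)\,L^2\,\big(8C(1+1/d)\vee D^\star\Lambda_{(D^\star)}\big)\,(1\vee r).$$ (i) For every $\theta^\circ\in F_\gamma^r$, $$\lim_{\varepsilon\to0}\mathbb E_{\theta^\circ}P_{\vartheta^M|Y}\big(\|\vartheta^M-\theta^\circ\|^2\le K^\star r^\star_\varepsilon\big)=1.$$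 (ii) For every unbounded family of reals $(K_\varepsilon)_{0<\varepsilon<1}$ that increases monotonically as $\varepsilon\downarrow0$, $$\lim_{\varepsilon\to0}\inf_{\theta^\circ\in F_\gamma^r}\mathbb E_{\theta^\circ}P_{\vartheta^M|Y}\big(\|\vartheta^M-\theta^\circ\|^2\le K_\varepsilon r^\star_\varepsilon\big)=1.$$ -/

import Mathlib

open MeasureTheory ProbabilityTheory Filter Topology
open scoped ENNReal NNReal

noncomputable section

namespace SieveGSSM

/-! Sequences are indexed by `ℕ+`. The parameter space and the observation space are the space of
all real sequences `ℕ+ → ℝ` with its product σ-algebra. -/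

/-- The squared `ℓ²` norm of a real sequence, with value `∞` if it is not square summable. -/
def normSq (x : ℕ+ → ℝ) : ℝ≥0∞ := ∑' j, ENNReal.ofReal (x j ^ 2)

/-- The squared weighted norm `∑ⱼ xⱼ² / γⱼ`, with value `∞` if the series diverges. -/
def weightedNormSq (γ x : ℕ+ → ℝ) : ℝ≥0∞ := ∑' j, ENNReal.ofReal (x j ^ 2 / γ j)

/-- The ellipsoid of all sequences `θ` of finite weighted norm with `‖θ - μ‖²_γ ≤ r`. -/
def ellipsoid (γ μ : ℕ+ → ℝ) (r : ℝ) : Set (ℕ+ → ℝ) :=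
  {θ | weightedNormSq γ θ < ∞ ∧ weightedNormSq γ (θ - μ) ≤ ENNReal.ofReal r}

/-- The smallest minimiser of `f` over the positive integers (`1` if there is no minimiser). -/
def argmin (f : ℕ+ → ℝ) : ℕ+ := by
  classical
  exact if h : ∃ m, ∀ k, f m ≤ f k then PNat.find h else 1

/-- `Λⱼ = λⱼ⁻²`. -/
def ev (lam : ℕ+ → ℝ) (j : ℕ+) : ℝ := (lam j ^ 2)⁻¹

/-- `Λ₍ₘ₎ = max_{1 ≤ j ≤ m} Λⱼ`. -/
def evMax (lam : ℕ+ → ℝ) (m : ℕ+) : ℝ :=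
  (Finset.Icc 1 m).sup' ⟨1, Finset.mem_Icc.2 ⟨le_rfl, one_le⟩⟩ (ev lam)

/-- `Λ̄ₘ = m⁻¹ ∑_{1 ≤ j ≤ m} Λⱼ`. -/
def evMean (lam : ℕ+ → ℝ) (m : ℕ+) : ℝ := (m : ℝ)⁻¹ * ∑ j ∈ Finset.Icc 1 m, ev lam j

/-- `G_ε`, the largest `m` with `1 ≤ m ≤ ⌊1/ε⌋` and `ε Λ₍ₘ₎ ≤ Λ₁` (for `0 < ε < 1`, where the
set of such `m` contains `1`). -/
def maxDim (lam : ℕ+ → ℝ) (ε : ℝ) : ℕ+ := by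
  classical
  exact ((Finset.Icc 1 (⌊ε⁻¹⌋₊.toPNat')).filter (fun m => ε * evMax lam m ≤ ev lam 1)).sup id

/-- The minimax dimension `m*_ε`. -/
def minimaxDim (γ lam : ℕ+ → ℝ) (ε : ℝ) : ℕ+ :=
  argmin (fun m => max (γ m) (ε * m * evMean lam m))

/-- The minimax rate `r*_ε`. -/
def minimaxRate (γ lam : ℕ+ → ℝ) (ε : ℝ) : ℝ :=
  max (γ (minimaxDim γ lam ε)) (ε * minimaxDim γ lam ε * evMean lam (minimaxDim γ lam ε))

/-- `κ*`, the infimum over `0 < ε < ε₀` of `(r*_ε)⁻¹ [γ_{m*} ∧ ε m* Λ̄_{m*}]`. -/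
def kappaStar (γ lam : ℕ+ → ℝ) (ε₀ : ℝ) : ℝ :=
  sInf ((fun ε => (minimaxRate γ lam ε)⁻¹ *
    min (γ (minimaxDim γ lam ε)) (ε * minimaxDim γ lam ε * evMean lam (minimaxDim γ lam ε))) ''
      Set.Ioo 0 ε₀)

/-- The law of an i.i.d. sequence of standard normal variables. -/
def noise : Measure (ℕ+ → ℝ) := Measure.infinitePi (fun _ => gaussianReal 0 1)

instance : IsProbabilityMeasure noise := by unfold noise; infer_instance

/-- The law of the observation `Yⱼ = λⱼ ϑⱼ + √ε ξⱼ` given the parameter `ϑ`, where `ξ` is an i.i.d.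
standard normal sequence independent of `ϑ`. -/
def obsKernel (lam : ℕ+ → ℝ) (ε : ℝ) : Kernel (ℕ+ → ℝ) (ℕ+ → ℝ) :=
  (Kernel.id ×ₖ Kernel.const _ noise).map
    (fun p : (ℕ+ → ℝ) × (ℕ+ → ℝ) => fun j => lam j * p.1 j + √ε * p.2 j)

instance (lam : ℕ+ → ℝ) (ε : ℝ) : IsFiniteKernel (obsKernel lam ε) := by
  unfold obsKernel; infer_instance

/-- The posterior variances `σⱼ = (λⱼ² ε⁻¹ + ςⱼ⁻¹)⁻¹`. -/
def postVar (lam : ℕ+ → ℝ) (ς : ℕ+ → ℝ≥0) (ε : ℝ) (j : ℕ+) : ℝ :=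
  (lam j ^ 2 * ε⁻¹ + (ς j : ℝ)⁻¹)⁻¹

/-- The prior law of the `j`-th coordinate of `ϑᵐ`. -/
def sieveCoord (μ : ℕ+ → ℝ) (ς : ℕ+ → ℝ≥0) (m j : ℕ+) : Measure ℝ :=
  if j ≤ m then gaussianReal (μ j) (ς j) else Measure.dirac (μ j)

instance (μ : ℕ+ → ℝ) (ς : ℕ+ → ℝ≥0) (m j : ℕ+) :
    IsProbabilityMeasure (sieveCoord μ ς m j) := by
  unfold sieveCoord; split_ifs <;> infer_instance

/-- The sieve prior: the law of `ϑᵐ`, with independent coordinates. -/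
def sievePrior (μ : ℕ+ → ℝ) (ς : ℕ+ → ℝ≥0) (m : ℕ+) : Measure (ℕ+ → ℝ) :=
  Measure.infinitePi (sieveCoord μ ς m)

instance (μ : ℕ+ → ℝ) (ς : ℕ+ → ℝ≥0) (m : ℕ+) : IsProbabilityMeasure (sievePrior μ ς m) := by
  unfold sievePrior; infer_instance

/-- The unnormalised prior weight `exp(-3 C m / 2) ∏_{j ≤ m} (ςⱼ / σⱼ)^{1/2}` of the dimension
`m`. -/
def dimWeight (lam : ℕ+ → ℝ) (ς : ℕ+ → ℝ≥0) (C ε : ℝ) (m : ℕ+) : ℝ :=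
  Real.exp (-3 * C * m / 2) * ∏ j ∈ Finset.Icc 1 m, √((ς j : ℝ) / postVar lam ς ε j)

/-- The prior probability `p_M(m)` of the random dimension `M`, for `1 ≤ m ≤ G_ε`. -/
def dimPrior (lam : ℕ+ → ℝ) (ς : ℕ+ → ℝ≥0) (C ε : ℝ) (m : ℕ+) : ℝ :=
  dimWeight lam ς C ε m / ∑ k ∈ Finset.Icc 1 (maxDim lam ε), dimWeight lam ς C ε k

/-- The hierarchical prior: the law of `ϑ^M`, where `M` has the law `p_M` on `{1, …, G_ε}` and,
given `M = m`, the sequence `ϑ^M` has the law of `ϑᵐ`. -/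
def hierPrior (lam μ : ℕ+ → ℝ) (ς : ℕ+ → ℝ≥0) (C ε : ℝ) : Measure (ℕ+ → ℝ) :=
  ∑ m ∈ Finset.Icc 1 (maxDim lam ε), (dimPrior lam ς C ε m).toNNReal • sievePrior μ ς m

instance (lam μ : ℕ+ → ℝ) (ς : ℕ+ → ℝ≥0) (C ε : ℝ) :
    IsFiniteMeasure (hierPrior lam μ ς C ε) := by
  unfold hierPrior; infer_instance

/-- The posterior `P_{ϑ^M | Y}`: the regular conditional distribution of the parameter given the
observation when the parameter has the hierarchical prior. -/
def hierPosterior (lam μ : ℕ+ → ℝ) (ς : ℕ+ → ℝ≥0) (C ε : ℝ) : Kernel (ℕ+ → ℝ) (ℕ+ → ℝ) :=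
  posterior (obsKernel lam ε) (hierPrior lam μ ς C ε)

/-- `E_{θ°} P_{ϑ^M | Y}(‖ϑ^M - θ°‖² ≤ t)`, where `Y` is generated with the true parameter `θ°`. -/
def expectedPostMass (lam μ : ℕ+ → ℝ) (ς : ℕ+ → ℝ≥0) (C ε : ℝ) (θ₀ : ℕ+ → ℝ) (t : ℝ) : ℝ≥0∞ :=
  ∫⁻ y, hierPosterior lam μ ς C ε y {θ | normSq (θ - θ₀) ≤ ENNReal.ofReal t}
    ∂(obsKernel lam ε θ₀)

/-- The condition on the prior variances, with constant `d`. -/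
def PriorVarianceCond (lam : ℕ+ → ℝ) (ς : ℕ+ → ℝ≥0) (d : ℝ) : Prop :=
  ∀ ε ∈ Set.Ioo (0 : ℝ) 1, ∀ j ≤ maxDim lam ε, d * max (√ε * √(ev lam j)) (ε * ev lam j) ≤ ς j

/-- The condition on the sequence `λ`, with constants `C` and `L`. -/
structure OperatorCond (lam : ℕ+ → ℝ) (C L : ℝ) : Prop where
  tail_le : ∀ k j i : ℕ+, k < j → i ≤ k → lam j ^ 2 ≤ C * lam i ^ 2
  evMax_mul_le : ∀ k l : ℕ+, evMax lam (k * l) ≤ evMax lam k * evMax lam l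
  one_le_ratio : ∀ k : ℕ+, 1 ≤ evMax lam k / evMean lam k
  ratio_le : ∀ k : ℕ+, evMax lam k / evMean lam k ≤ L

/-- `D* = ⌈5 L / κ*⌉`. -/
def DStar (L κ : ℝ) : ℕ+ := ⌈5 * L / κ⌉₊.toPNat'

/-- The constant `K*`. -/
def KStar (lam : ℕ+ → ℝ) (d r C L κ : ℝ) : ℝ :=
  16 * max (1 + 1 / d) (r / d ^ 2) * L ^ 2 *
    max (8 * C * (1 + 1 / d)) (DStar L κ * evMax lam (DStar L κ)) * max 1 r

end SieveGSSM

end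

open SieveGSSM

noncomputable section

namespace SieveGSSM

/-! ### Product measures, Gaussian integrals and shifted white noise. -/

section

section ProductMeasure

variable {ι : Type*} {X : ι → Type*} [∀ i, MeasurableSpace (X i)]

/-! Write `k` for the minimax dimension and `R` for the minimax rate. Given `M = m`, the posterior
is an explicit Gaussian law (`sievePrior_compProd_obsKernel`). The prior weights of the dimensions
cancel the normalising constants of the likelihoods (`dimPrior_mul_likelihoodRatio`), so the
posterior weight of `m` is proportional to the exponential of a penalised contrast `∑_{j ≤ m} (wⱼ
Xⱼ² / 2 - 3C/2)`, with `w` the shrinkage factor and `X` the standardised observation. The abstract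
posterior is determined only up to null sets of the marginal law of `Y`; since `θ - μ` is square
summable and `λ` is bounded, the law of `Y` under `θ` is absolutely continuous with respect to that
marginal, so the formula may be used under `θ` (`lintegral_hierPosterior`).

Every dimension is compared with `k`. If `m < k` and the bias at `m` is a large multiple of `R`, the
signal lost between `m` and `k` outweighs the penalty. If `m > D k`, the penalty outweighs the
signal gained. Gaussian Laplace transforms bound the expected weight of each such `m` by `exp(-k/8)`
(`lintegral_dimPost_le_of_lt`, `lintegral_dimPost_le_of_gt`). There are at most `G_ε` of them and
`log G_ε = o(k)`, so their total weight vanishes. All other dimensions have bias of order `R` and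
are at most `D k`. Their draws agree with a draw in one largest dimension on the coordinates they
keep, so a single Chernoff bound (`lintegral_noise_drawError_le`) controls them together;
submultiplicativity of `Λ₍ₘ₎` keeps its level of order `R`.

Both parts follow from `one_le_expectedPostMass_add`, in which `D` depends on a bound `ρ` for the
ratio of the bias at `k` to `γ_k`. For fixed `θ` this ratio tends to zero, so `ρ = κ*` and `D = D*`
suffice; uniformly over the ellipsoid only `ρ = r` is available, and the larger constant is absorbed
by `K_ε`. -/

theorem lintegral_prod_infinitePi (ν : ∀ i, Measure (X i)) [∀ i, IsProbabilityMeasure (ν i)]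
    (s : Finset ι) (f : ∀ i, X i → ℝ≥0∞) (hf : ∀ i, Measurable (f i)) :
    ∫⁻ z, ∏ j ∈ s, f j (z j) ∂(Measure.infinitePi ν) = ∏ j ∈ s, ∫⁻ x, f j x ∂(ν j) := by
  rw [lintegral_prod_eq_prod_lintegral_of_indepFun s (fun j (z : ∀ i, X i) => f j (z j))
    (iIndepFun_infinitePi (X := f) hf) (fun i => (hf i).comp (measurable_pi_apply i))]
  refine Finset.prod_congr rfl fun j _ => ?_
  rw [← (measurePreserving_eval_infinitePi ν j).lintegral_comp (hf j)]

/-- Changing finitely many factors of an infinite product measure by densities. -/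
theorem infinitePi_eq_withDensity (ν ν' : ∀ i, Measure (X i)) [∀ i, IsProbabilityMeasure (ν i)]
    [∀ i, IsProbabilityMeasure (ν' i)] (s : Finset ι) (f : ∀ i, X i → ℝ≥0∞)
    (hf : ∀ i, Measurable (f i)) (h : ∀ j ∈ s, ν' j = (ν j).withDensity (f j))
    (h' : ∀ j ∉ s, ν' j = ν j) :
    Measure.infinitePi ν' = (Measure.infinitePi ν).withDensity (fun z => ∏ j ∈ s, f j (z j)) := by
  classical
  symm
  refine Measure.eq_infinitePi _ fun u t ht => ?_
  have hm : MeasurableSet (Set.pi (u : Set ι) t) := .pi u.countable_toSet fun i _ => ht i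
  rw [withDensity_apply _ hm, ← lintegral_indicator hm]
  -- Density and box indicator become one product over `s ∪ u`, to which independence applies factor
  -- by factor.
  have e : ∀ z : (∀ i, X i), (Set.pi (u : Set ι) t).indicator (fun z => ∏ j ∈ s, f j (z j)) z =
      ∏ j ∈ s ∪ u, ((if j ∈ s then f j (z j) else 1) *
        (if j ∈ u then (t j).indicator 1 (z j) else 1)) := by
    intro z
    rw [Finset.prod_mul_distrib, Finset.prod_ite_mem, Finset.prod_ite_mem,
      Finset.union_inter_cancel_left, Finset.union_inter_cancel_right]
    by_cases hz : z ∈ Set.pi (u : Set ι) t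
    · rw [Set.indicator_of_mem hz, Finset.prod_congr (s₁ := u) rfl (g := fun _ => 1)]
      · simp
      · intro j hj
        rw [Set.indicator_of_mem (hz j hj)]; rfl
    · rw [Set.indicator_of_notMem hz]
      simp only [Set.mem_pi, not_forall] at hz
      obtain ⟨j, hj, hzj⟩ := hz
      rw [Finset.prod_eq_zero hj (Set.indicator_of_notMem hzj _), mul_zero]
  simp_rw [e]
  rw [lintegral_prod_infinitePi ν (s ∪ u) (fun j x => (if j ∈ s then f j x else 1) *
        (if j ∈ u then (t j).indicator 1 x else 1))]
  · rw [← Finset.prod_subset (Finset.subset_union_right (s₁ := s) (s₂ := u))]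
    · refine Finset.prod_congr rfl fun j hj => ?_
      simp only [hj, if_true]
      by_cases hjs : j ∈ s
      · simp only [hjs, if_true]
        rw [h j hjs, withDensity_apply _ (ht j), ← lintegral_indicator (ht j)]
        refine lintegral_congr fun x => ?_
        by_cases hx : x ∈ t j <;> simp [hx]
      · simp only [hjs, if_false, one_mul]
        rw [lintegral_indicator_one (ht j), h' j hjs]
    · intro j hj hju
      have hjs : j ∈ s := by simpa [hju] using hj
      simp only [hjs, hju, if_true, if_false, mul_one]
      have := measure_univ (μ := ν' j)
      rwa [h j hjs, withDensity_apply _ .univ, Measure.restrict_univ] at this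
  · intro j
    refine Measurable.mul ?_ ?_
    · split_ifs
      exacts [hf j, measurable_const]
    · split_ifs
      exacts [measurable_one.indicator (ht j), measurable_const]

/-- The two sides agree on rectangles of square cylinders, a generating π-system. This turns
statements about independent pairs, one per coordinate, into statements about a pair of independent
sequences. -/
theorem infinitePi_prod_map_unzip (ν ν' : ∀ i, Measure (X i)) [∀ i, IsProbabilityMeasure (ν i)]
    [∀ i, IsProbabilityMeasure (ν' i)] :
    (Measure.infinitePi fun i => (ν i).prod (ν' i)).map
      (fun w => (fun i => (w i).1, fun i => (w i).2)) =
    (Measure.infinitePi ν).prod (Measure.infinitePi ν') := by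
  classical
  symm
  have hmeas : Measurable (fun w : ∀ i, X i × X i => (fun i => (w i).1, fun i => (w i).2)) := by
    fun_prop
  have hmem : Set.univ ∈ squareCylinders fun i ↦ {s : Set (X i) | MeasurableSet s} :=
    ⟨∅, fun _ => Set.univ, by simp, by simp⟩
  have hpi := isPiSystem_squareCylinders (α := X) (C := fun i ↦ {s : Set (X i) | MeasurableSet s})
    (fun i => MeasurableSpace.isPiSystem_measurableSet) (fun i => MeasurableSet.univ)
  refine Measure.prod_eq_generateFrom generateFrom_squareCylinders generateFrom_squareCylinders
    hpi hpi ⟨fun _ => Set.univ, fun _ => hmem, fun _ => by simp, by simp [Set.iUnion_const]⟩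
      ⟨fun _ => Set.univ, fun _ => hmem, fun _ => by simp, by simp [Set.iUnion_const]⟩ ?_
  rintro _ ⟨s, t, ht, rfl⟩ _ ⟨s', t', ht', rfl⟩
  have ht : ∀ i, MeasurableSet (t i) := fun i => ht i trivial
  have ht' : ∀ i, MeasurableSet (t' i) := fun i => ht' i trivial
  rw [Measure.map_apply hmeas ((MeasurableSet.pi s.countable_toSet fun i _ => ht i).prod
    (.pi s'.countable_toSet fun i _ => ht' i))]
  have e : (fun w : ∀ i, X i × X i => (fun i => (w i).1, fun i => (w i).2)) ⁻¹'
      ((s : Set ι).pi t ×ˢ (s' : Set ι).pi t') =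
      ((s ∪ s' : Finset ι) : Set ι).pi (fun i => (if i ∈ s then t i else Set.univ) ×ˢ
        (if i ∈ s' then t' i else Set.univ)) := by
    ext w
    simp only [Set.mem_preimage, Set.mem_prod, Set.mem_pi, Finset.mem_coe, Finset.mem_union]
    constructor
    · rintro ⟨h1, h2⟩ i -
      constructor
      · split_ifs with h
        exacts [h1 i h, trivial]
      · split_ifs with h
        exacts [h2 i h, trivial]
    · intro h
      refine ⟨fun i hi => ?_, fun i hi => ?_⟩
      · simpa [hi] using (h i (Or.inl hi)).1
      · simpa [hi] using (h i (Or.inr hi)).2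
  have hm1 : ∀ i, MeasurableSet (if i ∈ s then t i else Set.univ) := fun i => by
    split_ifs
    exacts [ht i, .univ]
  have hm2 : ∀ i, MeasurableSet (if i ∈ s' then t' i else Set.univ) := fun i => by
    split_ifs
    exacts [ht' i, .univ]
  rw [e, Measure.infinitePi_pi _ fun i _ => (hm1 i).prod (hm2 i)]
  simp_rw [Measure.prod_prod]
  rw [Finset.prod_mul_distrib, ← Finset.prod_subset (Finset.subset_union_left (s₂ := s')),
    ← Finset.prod_subset (Finset.subset_union_right (s₁ := s)),
    Measure.infinitePi_pi _ fun i _ => ht i, Measure.infinitePi_pi _ fun i _ => ht' i]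
  · congr 1 <;> refine Finset.prod_congr rfl fun j hj => ?_ <;> simp [hj]
  · intro j _ hj; simp [hj]
  · intro j _ hj; simp [hj]

end ProductMeasure

theorem gaussianReal_prod_map_rotation {a b : ℝ} (h : a ^ 2 + b ^ 2 = 1) :
    ((gaussianReal 0 1).prod (gaussianReal 0 1)).map
      (fun p => (a * p.1 + b * p.2, -b * p.1 + a * p.2)) =
    (gaussianReal 0 1).prod (gaussianReal 0 1) := by
  have hn : ‖(⟨a, b⟩ : ℂ)‖ = 1 := by
    rw [Complex.norm_def, Complex.normSq_mk, ← sq, ← sq, h, Real.sqrt_one]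
  have h0 : (⟨a, b⟩ : ℂ) ≠ 0 := by
    intro h0; simp [h0] at hn
  have hc := Complex.cos_arg h0
  have hs := Complex.sin_arg (⟨a, b⟩ : ℂ)
  rw [hn, div_one] at hc hs
  have := IsGaussian.map_rotation_eq_self (μ := gaussianReal 0 1) (by simp)
    (Complex.arg ⟨a, b⟩)
  simp only [ContinuousLinearMap.rotation, hc, hs] at this
  exact this

/-- Coordinatewise rotations preserve the law of two independent white noises. -/
theorem noise_prod_map_rotation {a b : ℕ+ → ℝ} (h : ∀ j, a j ^ 2 + b j ^ 2 = 1) :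
    (noise.prod noise).map (fun p => ((fun j => a j * p.1 j + b j * p.2 j : ℕ+ → ℝ),
      (fun j => -b j * p.1 j + a j * p.2 j : ℕ+ → ℝ))) = noise.prod noise := by
  unfold noise
  rw [← infinitePi_prod_map_unzip, Measure.map_map (by fun_prop) (by fun_prop)]
  conv_rhs => rw [show (fun _ : ℕ+ => (gaussianReal 0 1).prod (gaussianReal 0 1)) = fun j =>
    ((gaussianReal 0 1).prod (gaussianReal 0 1)).map
      (fun p => (a j * p.1 + b j * p.2, -b j * p.1 + a j * p.2)) from
      funext fun j => (gaussianReal_prod_map_rotation (h j)).symm]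
  rw [← Measure.infinitePi_map_pi _ (fun j => by fun_prop),
    Measure.map_map (by fun_prop) (by fun_prop)]
  rfl

/-- Completing the square turns the integrand into a multiple of a Gaussian density of variance `1 /
(1 - 2au²)`. The sign of `a` is free: both signs are needed later. -/
theorem lintegral_exp_mul_sq_gaussian (a c u : ℝ) (h : 2 * a * u ^ 2 < 1) :
    ∫⁻ z, ENNReal.ofReal (Real.exp (a * (c + u * z) ^ 2)) ∂(gaussianReal 0 1) =
      ENNReal.ofReal ((√(1 - 2 * a * u ^ 2))⁻¹ *
        Real.exp (a * c ^ 2 / (1 - 2 * a * u ^ 2))) := by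
  set k := 1 - 2 * a * u ^ 2 with hk
  have hk0 : 0 < k := by linarith
  rw [gaussianReal_of_var_ne_zero 0 one_ne_zero,
    lintegral_withDensity_eq_lintegral_mul _ (measurable_gaussianPDF 0 1) (by fun_prop)]
  obtain ⟨v, hv⟩ : ∃ v : ℝ≥0, (v : ℝ) = k⁻¹ := ⟨⟨k⁻¹, by positivity⟩, rfl⟩
  have hv0 : v ≠ 0 := by
    rw [Ne, ← NNReal.coe_eq_zero, hv]; exact inv_ne_zero hk0.ne'
  have e : ∀ z : ℝ, (gaussianPDF 0 1 * fun z => ENNReal.ofReal (Real.exp (a * (c + u * z) ^ 2))) z =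
      ENNReal.ofReal ((√k)⁻¹ * Real.exp (a * c ^ 2 / k)) * gaussianPDF (2 * a * c * u / k) v z := by
    intro z
    simp only [Pi.mul_apply, gaussianPDF]
    rw [← ENNReal.ofReal_mul (gaussianPDFReal_nonneg _ _ _), ← ENNReal.ofReal_mul (by positivity)]
    congr 1
    simp only [gaussianPDFReal, hv, NNReal.coe_one]
    rw [mul_assoc, ← Real.exp_add]
    have h1 : √(2 * Real.pi * k⁻¹) = √(2 * Real.pi) * (√k)⁻¹ := by
      rw [Real.sqrt_mul (by positivity), Real.sqrt_inv]
    have hs : √k ≠ 0 := by positivity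
    rw [h1, mul_inv, inv_inv, mul_one,
      show (√k)⁻¹ * Real.exp (a * c ^ 2 / k) * ((√(2 * Real.pi))⁻¹ * √k *
        Real.exp (-(z - 2 * a * c * u / k) ^ 2 / (2 * k⁻¹))) = (√(2 * Real.pi))⁻¹ *
        (Real.exp (a * c ^ 2 / k) * Real.exp (-(z - 2 * a * c * u / k) ^ 2 / (2 * k⁻¹))) by
        field_simp, ← Real.exp_add]
    congr 2
    have hk1 : k ≠ 0 := hk0.ne'
    field_simp
    rw [hk]
    ring
  simp_rw [e]
  rw [lintegral_const_mul _ (measurable_gaussianPDF _ _), lintegral_gaussianPDF_eq_one _ hv0,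
    mul_one]

theorem inv_sqrt_one_sub_le {x : ℝ} (h0 : 0 ≤ x) (h : x ≤ 1 / 2) :
    (√(1 - x))⁻¹ ≤ Real.exp x := by
  have h1 : Real.exp (-x) ≤ √(1 - x) := by
    apply Real.le_sqrt_of_sq_le
    rw [← Real.exp_nat_mul]
    have h2 : 0 < 1 - x := by linarith
    have h3 := Real.one_sub_inv_le_log_of_pos h2
    rw [← Real.exp_log h2, Real.exp_le_exp]
    have h4 : (1 - x)⁻¹ ≤ 1 + 2 * x := by
      rw [inv_le_iff_one_le_mul₀ h2]; nlinarith
    push_cast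
    linarith
  calc (√(1 - x))⁻¹ ≤ (Real.exp (-x))⁻¹ := inv_anti₀ (Real.exp_pos _) h1
    _ = Real.exp x := by rw [Real.exp_neg, inv_inv]

theorem lintegral_exp_mul_sq_gaussian_le {a c u : ℝ} (ha : 0 ≤ a) (h : 4 * a * u ^ 2 ≤ 1) :
    ∫⁻ z, ENNReal.ofReal (Real.exp (a * (c + u * z) ^ 2)) ∂(gaussianReal 0 1) ≤
      ENNReal.ofReal (Real.exp (2 * a * u ^ 2 + 2 * a * c ^ 2)) := by
  rw [lintegral_exp_mul_sq_gaussian a c u (by linarith)]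
  apply ENNReal.ofReal_le_ofReal
  rw [Real.exp_add]
  have h0 : 0 ≤ 2 * a * u ^ 2 := by positivity
  refine mul_le_mul (inv_sqrt_one_sub_le h0 (by linarith)) ?_ (Real.exp_pos _).le
    (Real.exp_pos _).le
  rw [Real.exp_le_exp, div_le_iff₀ (by linarith)]
  have : 0 ≤ a * c ^ 2 := by positivity
  nlinarith

theorem lintegral_exp_neg_mul_sq_gaussian_le {w δ : ℝ} (hw : 0 ≤ w) :
    ∫⁻ z, ENNReal.ofReal (Real.exp (-(w / 2) * (δ + z) ^ 2)) ∂(gaussianReal 0 1) ≤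
      ENNReal.ofReal (Real.exp (-(w * δ ^ 2 / (2 * (1 + w))))) := by
  have := lintegral_exp_mul_sq_gaussian (-(w / 2)) δ 1 (by linarith)
  simp only [one_mul] at this
  rw [this]
  apply ENNReal.ofReal_le_ofReal
  have e : 1 - 2 * -(w / 2) * 1 ^ 2 = 1 + w := by ring
  rw [e]
  have h1 : (√(1 + w))⁻¹ ≤ 1 := by
    apply inv_le_one_of_one_le₀
    rw [Real.one_le_sqrt]; linarith
  have h2 : -(w / 2) * δ ^ 2 / (1 + w) = -(w * δ ^ 2 / (2 * (1 + w))) := by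
    field_simp
  rw [h2]
  exact mul_le_of_le_one_left (Real.exp_pos _).le h1

theorem lintegral_exp_linear_gaussian (a b : ℝ) :
    ∫⁻ z, ENNReal.ofReal (Real.exp (a * z + b)) ∂(gaussianReal 0 1) =
      ENNReal.ofReal (Real.exp (a ^ 2 / 2 + b)) := by
  rw [← ofReal_integral_eq_lintegral_ofReal]
  · simp_rw [Real.exp_add, integral_mul_const]
    have := congrFun (mgf_id_gaussianReal (μ := 0) (v := 1)) a
    simp only [mgf, id] at this
    rw [this]
    simp
  · simp_rw [Real.exp_add]
    exact (integrable_exp_mul_gaussianReal a).mul_const _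
  · exact ae_of_all _ fun z => (Real.exp_pos _).le

theorem gaussianReal_one_eq_withDensity (a : ℝ) :
    gaussianReal a 1 = (gaussianReal 0 1).withDensity
      (fun z => ENNReal.ofReal (Real.exp (a * z + -(a ^ 2 / 2)))) := by
  rw [gaussianReal_of_var_ne_zero a one_ne_zero, gaussianReal_of_var_ne_zero 0 one_ne_zero,
    ← withDensity_mul _ (measurable_gaussianPDF 0 1) (by fun_prop)]
  congr 1
  ext z
  simp only [Pi.mul_apply, gaussianPDF]
  rw [← ENNReal.ofReal_mul (gaussianPDFReal_nonneg _ _ _)]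
  simp only [gaussianPDFReal, NNReal.coe_one]
  rw [mul_assoc (√(2 * Real.pi * 1))⁻¹, ← Real.exp_add]
  congr 3
  ring

theorem gaussianReal_var_eq_withDensity {τ : ℝ} (hτ : 0 < τ) {v : ℝ≥0} (hv : (v : ℝ) = τ ^ 2) :
    gaussianReal 0 v = (gaussianReal 0 1).withDensity
      (fun z => ENNReal.ofReal (τ⁻¹ * Real.exp (z ^ 2 * (1 - (τ ^ 2)⁻¹) / 2))) := by
  have hv0 : v ≠ 0 := by
    rw [Ne, ← NNReal.coe_eq_zero, hv]; positivity
  rw [gaussianReal_of_var_ne_zero 0 hv0, gaussianReal_of_var_ne_zero 0 one_ne_zero,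
    ← withDensity_mul _ (measurable_gaussianPDF 0 1) (by fun_prop)]
  congr 1
  ext z
  simp only [Pi.mul_apply, gaussianPDF]
  rw [← ENNReal.ofReal_mul (gaussianPDFReal_nonneg _ _ _)]
  simp only [gaussianPDFReal, NNReal.coe_one, hv]
  rw [Real.sqrt_mul (by positivity), Real.sqrt_sq hτ.le, mul_one, mul_inv,
    show ∀ x y z w : ℝ, x * y * (z * w) = x * z * (y * w) from fun x y z w => by ring,
    ← Real.exp_add]
  congr 3
  field_simp
  ring

/-- The law of white noise shifted by a square summable sequence is absolutely continuous. -/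
theorem noise_map_add_absolutelyContinuous {a : ℕ+ → ℝ} (ha : Summable fun j => a j ^ 2) :
    noise.map (fun z j => a j + z j) ≪ noise := by
  classical
  have hN : noise.map (fun z j => a j + z j) = Measure.infinitePi fun j => gaussianReal (a j) 1 := by
    unfold noise
    rw [Measure.infinitePi_map_pi _ (f := fun j x => a j + x) (fun j => by fun_prop)]
    simp_rw [gaussianReal_map_const_add, zero_add]
  rw [hN]
  set P : Measure (ℕ+ → ℝ) := Measure.infinitePi fun j => gaussianReal (a j) 1 with hP
  set c : ℝ := Real.exp (∑' j, a j ^ 2) with hc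
  have hc0 : 0 < c := Real.exp_pos _
  -- On a cylinder only finitely many shifts matter. The likelihood ratio `f` there satisfies `f ≤ M
  -- + f² / M`, and its second moment is at most `c`, whatever the cylinder.
  have key : ∀ t ∈ measurableCylinders (fun _ : ℕ+ => ℝ), ∀ M : ℝ, 0 < M →
      P.real t ≤ M * noise.real t + c / M := by
    intro t ht M hM
    obtain ⟨s, S, hS, rfl⟩ := (mem_measurableCylinders _).1 ht
    have hm : MeasurableSet (cylinder s S : Set (ℕ+ → ℝ)) := hS.cylinder
    have h1 : P (cylinder s S) =
        Measure.infinitePi (fun j => gaussianReal (if j ∈ s then a j else 0) 1) (cylinder s S) := by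
      rw [hP, Measure.infinitePi_cylinder _ hS, Measure.infinitePi_cylinder _ hS]
      congr 2
      ext1 j
      simp
    have h2 : Measure.infinitePi (fun j => gaussianReal (if j ∈ s then a j else 0) 1) =
        noise.withDensity (fun z => ∏ j ∈ s,
          ENNReal.ofReal (Real.exp (a j * z j + -(a j ^ 2 / 2)))) := by
      refine infinitePi_eq_withDensity (fun _ => gaussianReal 0 1) _ s
        (fun j x => ENNReal.ofReal (Real.exp (a j * x + -(a j ^ 2 / 2)))) (fun j => by fun_prop)
        (fun j hj => ?_) (fun j hj => ?_)
      · simp only [hj, if_true]; exact gaussianReal_one_eq_withDensity _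
      · simp [hj]
    have hpt : ∀ z : ℕ+ → ℝ, ∏ j ∈ s, ENNReal.ofReal (Real.exp (a j * z j + -(a j ^ 2 / 2))) ≤
        ENNReal.ofReal M + ENNReal.ofReal M⁻¹ *
          ∏ j ∈ s, ENNReal.ofReal (Real.exp (2 * a j * z j + -(a j ^ 2))) := by
      intro z
      rw [← ENNReal.ofReal_prod_of_nonneg fun j _ => (Real.exp_pos _).le,
        ← ENNReal.ofReal_prod_of_nonneg fun j _ => (Real.exp_pos _).le,
        ← ENNReal.ofReal_mul (by positivity), ← ENNReal.ofReal_add hM.le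
        (mul_nonneg (by positivity) (Finset.prod_nonneg fun j _ => (Real.exp_pos _).le))]
      apply ENNReal.ofReal_le_ofReal
      have e : ∏ j ∈ s, Real.exp (2 * a j * z j + -(a j ^ 2)) =
          (∏ j ∈ s, Real.exp (a j * z j + -(a j ^ 2 / 2))) ^ 2 := by
        rw [← Finset.prod_pow]
        refine Finset.prod_congr rfl fun j _ => ?_
        rw [← Real.exp_nat_mul]
        congr 1; push_cast; ring
      rw [e]
      set f := ∏ j ∈ s, Real.exp (a j * z j + -(a j ^ 2 / 2))
      have : M + M⁻¹ * f ^ 2 - f = M⁻¹ * ((f - M / 2) ^ 2 + 3 / 4 * M ^ 2) := by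
        field_simp; ring
      have : 0 ≤ M⁻¹ * ((f - M / 2) ^ 2 + 3 / 4 * M ^ 2) := by positivity
      linarith
    have h3 : P (cylinder s S) ≤ ENNReal.ofReal M * noise (cylinder s S) +
        ENNReal.ofReal (c / M) := by
      rw [h1, h2, withDensity_apply _ hm]
      refine (lintegral_mono hpt).trans ?_
      rw [lintegral_add_left measurable_const, lintegral_const, Measure.restrict_apply .univ,
        Set.univ_inter]
      gcongr
      refine (setLIntegral_le_lintegral _ _).trans ?_
      rw [lintegral_const_mul _ (by fun_prop)]
      unfold noise
      rw [lintegral_prod_infinitePi _ s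
        (fun j x => ENNReal.ofReal (Real.exp (2 * a j * x + -(a j ^ 2)))) (fun j => by fun_prop)]
      simp_rw [lintegral_exp_linear_gaussian]
      rw [← ENNReal.ofReal_prod_of_nonneg fun j _ => (Real.exp_pos _).le, ← Real.exp_sum,
        ← ENNReal.ofReal_mul (by positivity), div_eq_inv_mul]
      apply ENNReal.ofReal_le_ofReal
      gcongr
      rw [hc, Real.exp_le_exp]
      refine le_trans (le_of_eq ?_) (ha.sum_le_tsum s fun j _ => sq_nonneg _)
      refine Finset.sum_congr rfl fun j _ => by ring
    have h4 := ENNReal.toReal_mono (by finiteness) h3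
    rw [ENNReal.toReal_add (by finiteness) (by finiteness), ENNReal.toReal_mul,
      ENNReal.toReal_ofReal hM.le, ENNReal.toReal_ofReal (by positivity)] at h4
    exact h4
  refine Measure.AbsolutelyContinuous.mk fun A hA h0 => ?_
  have bound : ∀ n : ℕ, P.real A ≤ (2 + c) * (1 / ((n : ℝ) + 1)) := by
    intro n
    set M : ℝ := (n : ℝ) + 1 with hM
    have hM1 : 1 ≤ M := by rw [hM]; linarith [n.cast_nonneg (α := ℝ)]
    have hM0 : 0 < M := by linarith
    -- The null set is approximated by a cylinder to within `1 / M²`, so that `M * noise t` is still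
    -- of order `1 / M`.
    obtain ⟨t, ht, hlt⟩ := exists_measure_symmDiff_lt_of_generateFrom_isSetRing
      (μ := noise + P) isSetRing_measurableCylinders
      ⟨{Set.univ}, Set.countable_singleton _, by simpa using univ_mem_measurableCylinders (fun _ : ℕ+ => ℝ),
        by simp⟩
      generateFrom_measurableCylinders.symm hA (ε := ENNReal.ofReal (1 / M ^ 2)) (by simp [hM0])
    rw [Measure.add_apply] at hlt
    have l1 : noise t ≤ ENNReal.ofReal (1 / M ^ 2) := by
      calc noise t ≤ noise (symmDiff t A ∪ A) := measure_mono (by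
            intro x hx; by_cases hxA : x ∈ A
            · exact Or.inr hxA
            · exact Or.inl (Or.inl ⟨hx, hxA⟩))
        _ ≤ noise (symmDiff t A) + noise A := measure_union_le _ _
        _ ≤ _ := by rw [h0, add_zero]; exact le_self_add.trans hlt.le
    have l2 : P A ≤ P t + ENNReal.ofReal (1 / M ^ 2) := by
      calc P A ≤ P (t ∪ symmDiff t A) := measure_mono (by
            intro x hx; by_cases hxt : x ∈ t
            · exact Or.inl hxt
            · exact Or.inr (Or.inr ⟨hx, hxt⟩))
        _ ≤ P t + P (symmDiff t A) := measure_union_le _ _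
        _ ≤ _ := by gcongr; exact le_add_self.trans hlt.le
    have l1' : noise.real t ≤ 1 / M ^ 2 := ENNReal.toReal_le_of_le_ofReal (by positivity) l1
    have l2' : P.real A ≤ P.real t + 1 / M ^ 2 := by
      have := ENNReal.toReal_mono (by finiteness) l2
      rwa [ENNReal.toReal_add (by finiteness) (by finiteness),
        ENNReal.toReal_ofReal (by positivity)] at this
    have := key t ht M hM0
    have l3 : M * noise.real t ≤ M * (1 / M ^ 2) := by gcongr
    have l4 : M * (1 / M ^ 2) = 1 / M := by field_simp
    have l5 : 1 / M ^ 2 ≤ 1 / M := by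
      apply one_div_le_one_div_of_le hM0; nlinarith
    have l6 : c / M = c * (1 / M) := by ring
    nlinarith
  have : P.real A ≤ 0 := by
    have ht := (tendsto_one_div_add_atTop_nhds_zero_nat (𝕜 := ℝ)).const_mul (2 + c)
    rw [mul_zero] at ht
    exact ge_of_tendsto' ht bound
  have h5 : P.real A = 0 := le_antisymm this measureReal_nonneg
  rwa [measureReal_eq_zero_iff] at h5

end

/-! ### Explicit posterior of a single sieve prior. -/

section

section Randomisation

variable {α β Ω : Type*} [MeasurableSpace α] [MeasurableSpace β] [MeasurableSpace Ω]

theorem randomKernel_apply (ν : Measure Ω) [IsProbabilityMeasure ν] {F : α × Ω → β}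
    (hF : Measurable F) (a : α) :
    ((Kernel.id ×ₖ Kernel.const α ν).map F) a = ν.map (fun z => F (a, z)) := by
  rw [Kernel.map_apply _ hF, Kernel.prod_apply, Kernel.id_apply, Kernel.const_apply,
    Measure.dirac_prod, Measure.map_map hF (by fun_prop)]
  rfl

/-- Both the observation and the sieve posterior draw are functions of a state and an independent
noise; their joint laws are then images of product measures. -/
theorem compProd_randomKernel (π : Measure α) [SFinite π] (ν : Measure Ω) [IsProbabilityMeasure ν]
    {F : α × Ω → β} (hF : Measurable F) :
    π ⊗ₘ ((Kernel.id ×ₖ Kernel.const α ν).map F) = (π.prod ν).map (fun p => (p.1, F p)) := by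
  ext s hs
  rw [Measure.compProd_apply hs, Measure.map_apply (by fun_prop) hs,
    Measure.prod_apply ((by fun_prop : Measurable fun p => (p.1, F p)) hs)]
  refine lintegral_congr fun a => ?_
  rw [randomKernel_apply ν hF, Measure.map_apply (by fun_prop) (measurable_prodMk_left hs)]
  rfl

end Randomisation

variable (lam μ : ℕ+ → ℝ) (ς : ℕ+ → ℝ≥0) (C ε : ℝ)

/-- The shrinkage factor `ςⱼ / (ςⱼ + ε Λⱼ)`. -/
def shrink (j : ℕ+) : ℝ := ς j / (ς j + ε * ev lam j)

/-- The standardised observation `(yⱼ - λⱼ μⱼ) / √ε`. -/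
def stdObs (y : ℕ+ → ℝ) (j : ℕ+) : ℝ := (y j - lam j * μ j) / √ε

/-- The logarithm of the unnormalised posterior probability of the dimension `m`. -/
def score (m : ℕ+) (y : ℕ+ → ℝ) : ℝ :=
  ∑ j ∈ Finset.Icc 1 m, (shrink lam ς ε j * stdObs lam μ ε y j ^ 2 / 2 - 3 * C / 2)

/-- The posterior probability of the dimension `m`. -/
def dimPost (m : ℕ+) (y : ℕ+ → ℝ) : ℝ :=
  Real.exp (score lam μ ς C ε m y) /
    ∑ k ∈ Finset.Icc 1 (maxDim lam ε), Real.exp (score lam μ ς C ε k y)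

/-- A draw from the posterior distribution of the sieve prior of dimension `m`, as a function of
the observation `y` and a white noise `z`. -/
def sieveDraw (m : ℕ+) (y z : ℕ+ → ℝ) (j : ℕ+) : ℝ :=
  if j ≤ m then μ j + shrink lam ς ε j * (y j / lam j - μ j) +
    √(shrink lam ς ε j * (ε * ev lam j)) * z j else μ j

theorem measurable_obs :
    Measurable (fun p : (ℕ+ → ℝ) × (ℕ+ → ℝ) => fun j => lam j * p.1 j + √ε * p.2 j) := by
  fun_prop

theorem obsKernel_apply (θ : ℕ+ → ℝ) :
    obsKernel lam ε θ = noise.map (fun z j => lam j * θ j + √ε * z j) :=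
  randomKernel_apply noise (measurable_obs lam ε) θ

instance : IsMarkovKernel (obsKernel lam ε) := by
  unfold obsKernel; exact Kernel.IsMarkovKernel.map _ (measurable_obs lam ε)

theorem measurable_sieveDraw (m : ℕ+) :
    Measurable fun p : (ℕ+ → ℝ) × (ℕ+ → ℝ) => sieveDraw lam μ ς ε m p.1 p.2 := by
  unfold sieveDraw
  refine measurable_pi_lambda _ fun j => ?_
  split_ifs <;> fun_prop

@[fun_prop]
theorem measurable_score (m : ℕ+) : Measurable (score lam μ ς C ε m) := by
  unfold score stdObs; fun_prop

@[fun_prop]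
theorem measurable_dimPost (m : ℕ+) : Measurable (dimPost lam μ ς C ε m) := by
  unfold dimPost; fun_prop

/-- The prior standard deviation of the `j`-th coordinate in dimension `m`. -/
def sieveSd (m j : ℕ+) : ℝ := if j ≤ m then √(ς j) else 0

/-- A Dirac coordinate is a Gaussian of variance zero, so one affine image of white noise covers all
coordinates. -/
theorem sievePrior_eq_map (m : ℕ+) :
    sievePrior μ ς m = noise.map (fun z j => μ j + sieveSd ς m j * z j) := by
  unfold noise sievePrior
  rw [Measure.infinitePi_map_pi _ (f := fun j x => μ j + sieveSd ς m j * x) (fun j => by fun_prop)]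
  congr 1
  ext1 j
  have : (gaussianReal 0 1).map (fun x => μ j + sieveSd ς m j * x) =
      gaussianReal (μ j) (.mk (sieveSd ς m j ^ 2) (sq_nonneg _)) := by
    rw [show (fun x => μ j + sieveSd ς m j * x) = (fun x => μ j + x) ∘ (fun x => sieveSd ς m j * x)
      from rfl, ← Measure.map_map (by fun_prop) (by fun_prop), gaussianReal_map_const_mul,
      gaussianReal_map_const_add]
    simp
  rw [this]
  unfold sieveCoord sieveSd
  by_cases h : j ≤ m
  · simp only [h, if_true]
    congr 1
    ext
    change (ς j : ℝ) = √(ς j) ^ 2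
    rw [Real.sq_sqrt (ς j).coe_nonneg]
  · simp only [h, if_false]
    rw [← gaussianReal_zero_var]
    congr 1
    ext
    change (0 : ℝ) = 0 ^ 2
    norm_num

/-- The standard deviation of the `j`-th observation under the sieve prior of dimension `m`. -/
def obsSd (m j : ℕ+) : ℝ := √(lam j ^ 2 * sieveSd ς m j ^ 2 + ε)

variable {ε}

theorem obsSd_pos (hε : 0 < ε) (m j : ℕ+) : 0 < obsSd lam ς ε m j := by
  unfold obsSd; positivity

theorem obsSd_sq (hε : 0 < ε) (m j : ℕ+) :
    obsSd lam ς ε m j ^ 2 = lam j ^ 2 * sieveSd ς m j ^ 2 + ε := by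
  unfold obsSd; exact Real.sq_sqrt (by positivity)

variable {lam}

theorem shrink_eq (hε : 0 < ε) (hlam : ∀ j, lam j ≠ 0) {m j : ℕ+} (h : j ≤ m) :
    shrink lam ς ε j = lam j ^ 2 * sieveSd ς m j ^ 2 / obsSd lam ς ε m j ^ 2 := by
  rw [obsSd_sq lam ς hε]
  simp only [sieveSd, h, if_true, Real.sq_sqrt (ς j).coe_nonneg, shrink, ev]
  have := hlam j
  have h2 : (0 : ℝ) < ς j + ε * (lam j ^ 2)⁻¹ := by have := (ς j).coe_nonneg; positivity
  have h3 : (0 : ℝ) < lam j ^ 2 * ς j + ε := by have := (ς j).coe_nonneg; positivity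
  rw [div_eq_div_iff h2.ne' h3.ne']
  field_simp

/-- Conjugacy of the sieve prior: the joint law of observation and parameter. -/
theorem sievePrior_compProd_obsKernel (hε : 0 < ε) (hlam : ∀ j, lam j ≠ 0) (m : ℕ+) :
    (sievePrior μ ς m ⊗ₘ obsKernel lam ε).map Prod.swap =
      (noise.map fun z j => lam j * μ j + obsSd lam ς ε m j * z j) ⊗ₘ
        ((Kernel.id ×ₖ Kernel.const _ noise).map fun p => sieveDraw lam μ ς ε m p.1 p.2) := by
  rw [compProd_randomKernel _ _ (measurable_sieveDraw lam μ ς ε m)]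
  unfold obsKernel
  rw [compProd_randomKernel _ _ (measurable_obs lam ε), sievePrior_eq_map]
  have e1 : ((noise.map fun z j => μ j + sieveSd ς m j * z j).prod noise) =
      (noise.prod noise).map (fun p => ((fun j => μ j + sieveSd ς m j * p.2 j : ℕ+ → ℝ), p.1)) := by
    conv_rhs => rw [← Measure.prod_swap (μ := noise) (ν := noise),
      Measure.map_map (by fun_prop) (by fun_prop)]
    conv_lhs => rw [← Measure.map_id (μ := noise), Measure.map_map (by fun_prop) (by fun_prop),
      Measure.map_prod_map _ _ (by fun_prop) (by fun_prop)]
    rfl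
  have e2 : ((noise.map fun z j => lam j * μ j + obsSd lam ς ε m j * z j).prod noise) =
      (noise.prod noise).map
        (fun p => ((fun j => lam j * μ j + obsSd lam ς ε m j * p.1 j : ℕ+ → ℝ), p.2)) := by
    conv_lhs => rw [← Measure.map_id (μ := noise), Measure.map_map (by fun_prop) (by fun_prop),
      Measure.map_prod_map _ _ (by fun_prop) (by fun_prop)]
    rfl
  have hd := measurable_sieveDraw lam μ ς ε m
  -- Rotating the observation noise `p.1` and the prior noise `p.2` by this angle gives two new
  -- independent noises: the first is the standardised observation, the second drives the posterior
  -- draw.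
  have hrot : ∀ j, (√ε / obsSd lam ς ε m j) ^ 2 +
      (lam j * sieveSd ς m j / obsSd lam ς ε m j) ^ 2 = 1 := by
    intro j
    have := obsSd_pos lam ς hε m j
    rw [div_pow, div_pow, ← add_div, div_eq_one_iff_eq (by positivity), obsSd_sq lam ς hε,
      Real.sq_sqrt hε.le]
    ring
  rw [e1, e2]
  conv_rhs => rw [← noise_prod_map_rotation hrot]
  rw [Measure.map_map (by fun_prop) (by fun_prop), Measure.map_map (by fun_prop) (by fun_prop),
    Measure.map_map (by fun_prop) (by fun_prop), Measure.map_map (by fun_prop) (by fun_prop)]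
  congr 1
  ext p : 1
  have hobs : ∀ j, lam j * (μ j + sieveSd ς m j * p.2 j) + √ε * p.1 j =
      lam j * μ j + obsSd lam ς ε m j * (√ε / obsSd lam ς ε m j * p.1 j +
        lam j * sieveSd ς m j / obsSd lam ς ε m j * p.2 j) := by
    intro j
    have := (obsSd_pos lam ς hε m j).ne'
    field_simp
    ring
  refine Prod.ext (funext hobs) (funext fun j => ?_)
  simp only [Function.comp, Prod.swap]
  unfold sieveDraw
  by_cases h : j ≤ m
  · simp only [h, if_true]
    rw [shrink_eq ς hε hlam h]
    have ht := obsSd_pos lam ς hε m j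
    have hs : 0 ≤ sieveSd ς m j := by
      unfold sieveSd
      split_ifs
      exact Real.sqrt_nonneg _
    have hl := hlam j
    have hr : √(lam j ^ 2 * sieveSd ς m j ^ 2 / obsSd lam ς ε m j ^ 2 * (ε * ev lam j)) =
        sieveSd ς m j * √ε / obsSd lam ς ε m j := by
      rw [show lam j ^ 2 * sieveSd ς m j ^ 2 / obsSd lam ς ε m j ^ 2 * (ε * ev lam j) =
        (sieveSd ς m j / obsSd lam ς ε m j) ^ 2 * ε by unfold ev; field_simp,
        Real.sqrt_mul (by positivity), Real.sqrt_sq (by positivity)]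
      ring
    rw [hr]
    have h2 := obsSd_sq lam ς hε m j
    have h3 : √ε * √ε = ε := Real.mul_self_sqrt hε.le
    set t := obsSd lam ς ε m j
    set s := sieveSd ς m j
    have e3 : s * √ε / t * (-(lam j * s / t) * p.1 j + √ε / t * p.2 j) =
        (s / t ^ 2) * (-(lam j * s * √ε * p.1 j) + √ε * √ε * p.2 j) := by
      field_simp
    rw [e3, h3]
    -- Eliminating `ε` leaves an algebraic identity in `t`, `s` and `λⱼ`.
    have e4 : ε = t ^ 2 - lam j ^ 2 * s ^ 2 := by rw [h2]; ring
    rw [show s / t ^ 2 * (-(lam j * s * √ε * p.1 j) + ε * p.2 j) =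
      s / t ^ 2 * (-(lam j * s * √ε * p.1 j) + (t ^ 2 - lam j ^ 2 * s ^ 2) * p.2 j) by
      rw [← e4]]
    field_simp
    ring
  · simp [h, sieveSd]

end

/-! ### The hierarchical posterior as a mixture over dimensions. -/

section

theorem map_withDensity_comp {α β : Type*} [MeasurableSpace α] [MeasurableSpace β] (ν : Measure α)
    {T : α → β} (hT : Measurable T) {g : β → ℝ≥0∞} (hg : Measurable g) :
    (ν.withDensity (fun a => g (T a))).map T = (ν.map T).withDensity g := by
  ext s hs
  rw [Measure.map_apply hT hs, withDensity_apply _ (hT hs), withDensity_apply _ hs,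
    setLIntegral_map hs hg hT]

variable {lam μ : ℕ+ → ℝ} {ς : ℕ+ → ℝ≥0} {C ε : ℝ}

/-- The likelihood ratio of the sieve prior of dimension `m` relative to the prior mean. -/
def likelihoodRatio (lam μ : ℕ+ → ℝ) (ς : ℕ+ → ℝ≥0) (ε : ℝ) (m : ℕ+) (y : ℕ+ → ℝ) : ℝ≥0∞ :=
  ∏ j ∈ Finset.Icc 1 m, ENNReal.ofReal ((obsSd lam ς ε m j / √ε)⁻¹ *
    Real.exp (shrink lam ς ε j * stdObs lam μ ε y j ^ 2 / 2))

theorem measurable_likelihoodRatio (m : ℕ+) : Measurable (likelihoodRatio lam μ ς ε m) := by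
  unfold likelihoodRatio stdObs; fun_prop

/-- The two Gaussian laws share their means and differ in variance only in the first `m`
coordinates, so the density is a finite product. -/
theorem sieveObs_eq_withDensity (hε : 0 < ε) (hlam : ∀ j, lam j ≠ 0) (m : ℕ+) :
    (noise.map fun z j => lam j * μ j + obsSd lam ς ε m j * z j) =
      (noise.map fun z j => lam j * μ j + √ε * z j).withDensity
        (likelihoodRatio lam μ ς ε m) := by
  have hs : 0 < √ε := Real.sqrt_pos.2 hε
  rw [← map_withDensity_comp noise (by fun_prop) (measurable_likelihoodRatio m)]
  set τ : ℕ+ → ℝ := fun j => obsSd lam ς ε m j / √ε with hτ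
  have hτ0 : ∀ j, 0 < τ j := fun j => div_pos (obsSd_pos lam ς hε m j) hs
  have hτ2 : ∀ j, τ j ^ 2 = (lam j ^ 2 * sieveSd ς m j ^ 2 + ε) / ε := fun j => by
    rw [hτ]; simp only [div_pow]; rw [obsSd_sq lam ς hε, Real.sq_sqrt hε.le]
  have h1 : noise.map (fun z j => τ j * z j) = noise.withDensity
      (fun z => likelihoodRatio lam μ ς ε m (fun j => lam j * μ j + √ε * z j)) := by
    have e : noise.map (fun z j => τ j * z j) = Measure.infinitePi
        (fun j => gaussianReal 0 (.mk (τ j ^ 2) (sq_nonneg _))) := by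
      unfold noise
      rw [Measure.infinitePi_map_pi _ (f := fun j x => τ j * x) (fun j => by fun_prop)]
      simp_rw [gaussianReal_map_const_mul]
      simp
    rw [e, infinitePi_eq_withDensity (fun _ => gaussianReal 0 1) _ (Finset.Icc 1 m)
      (fun j z => ENNReal.ofReal ((τ j)⁻¹ * Real.exp (z ^ 2 * (1 - (τ j ^ 2)⁻¹) / 2)))
      (fun j => by fun_prop) (fun j _ => gaussianReal_var_eq_withDensity (hτ0 j) rfl)]
    · unfold noise likelihoodRatio
      congr 1
      ext z
      refine Finset.prod_congr rfl fun j hj => ?_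
      congr 3
      have hst : stdObs lam μ ε (fun j => lam j * μ j + √ε * z j) j = z j := by
        unfold stdObs; field_simp; ring
      rw [hst, shrink_eq ς hε hlam (Finset.mem_Icc.1 hj).2, hτ2, obsSd_sq lam ς hε]
      have : 0 < lam j ^ 2 * sieveSd ς m j ^ 2 + ε := by positivity
      field_simp
      ring
    · intro j hj
      have hj : ¬ j ≤ m := fun h => hj (Finset.mem_Icc.2 ⟨one_le, h⟩)
      congr 1
      ext
      change τ j ^ 2 = 1
      rw [hτ2]
      simp [sieveSd, hj, hε.ne']
  rw [← h1, Measure.map_map (by fun_prop) (by fun_prop)]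
  congr 1
  ext z j
  simp only [Function.comp, hτ]
  field_simp

/-- `ςⱼ / σⱼ` is the ratio of the marginal variance of `Yⱼ` to `ε`, so the product in the prior
weight cancels the Gaussian normalising constants exactly. -/
theorem dimPrior_mul_likelihoodRatio (hε : 0 < ε) {m : ℕ+} (hς : ∀ j ≤ m, 0 < ς j)
    (y : ℕ+ → ℝ) :
    ENNReal.ofReal (dimPrior lam ς C ε m) * likelihoodRatio lam μ ς ε m y =
      ENNReal.ofReal (Real.exp (score lam μ ς C ε m y) /
        ∑ k ∈ Finset.Icc 1 (maxDim lam ε), dimWeight lam ς C ε k) := by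
  have hs : 0 < √ε := Real.sqrt_pos.2 hε
  have hp : ∀ j, 0 ≤ (obsSd lam ς ε m j / √ε)⁻¹ *
      Real.exp (shrink lam ς ε j * stdObs lam μ ε y j ^ 2 / 2) := fun j => by
    have := obsSd_pos lam ς hε m j; positivity
  unfold likelihoodRatio
  rw [← ENNReal.ofReal_prod_of_nonneg fun j _ => hp j,
    ← ENNReal.ofReal_mul' (Finset.prod_nonneg fun j _ => hp j)]
  congr 1
  unfold dimPrior
  rw [div_mul_eq_mul_div]
  congr 1
  unfold dimWeight score
  rw [mul_assoc, ← Finset.prod_mul_distrib, Finset.sum_sub_distrib, sub_eq_add_neg, Real.exp_add,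
    mul_comm, Real.exp_sum]
  congr 1
  · refine Finset.prod_congr rfl fun j hj => ?_
    have hj := (Finset.mem_Icc.1 hj).2
    have e : (ς j : ℝ) / postVar lam ς ε j = (obsSd lam ς ε m j / √ε) ^ 2 := by
      have h0 : (0 : ℝ) < ς j := hς j hj
      rw [div_pow, obsSd_sq lam ς hε, Real.sq_sqrt hε.le]
      simp only [sieveSd, hj, if_true, Real.sq_sqrt h0.le, postVar]
      field_simp
    have h1 : 0 < obsSd lam ς ε m j / √ε := div_pos (obsSd_pos lam ς hε m j) hs
    rw [e, Real.sqrt_sq h1.le, ← mul_assoc, mul_inv_cancel₀ h1.ne', one_mul]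
  · rw [Finset.sum_const, nsmul_eq_mul]
    congr 1
    have : (Finset.Icc 1 m).card = (m : ℕ) := by simp
    rw [this]
    ring

theorem sum_dimWeight_pos (hε : 0 < ε) (hς : ∀ j ≤ maxDim lam ε, 0 < ς j) :
    0 < ∑ k ∈ Finset.Icc 1 (maxDim lam ε), dimWeight lam ς C ε k := by
  refine Finset.sum_pos (fun k hk => ?_) ⟨1, Finset.mem_Icc.2 ⟨le_rfl, one_le⟩⟩
  unfold dimWeight
  refine mul_pos (Real.exp_pos _) (Finset.prod_pos fun j hj => Real.sqrt_pos.2 ?_)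
  have h0 : (0 : ℝ) < ς j := hς j ((Finset.mem_Icc.1 hj).2.trans (Finset.mem_Icc.1 hk).2)
  unfold postVar
  positivity

theorem sum_exp_score_pos (y : ℕ+ → ℝ) :
    0 < ∑ k ∈ Finset.Icc 1 (maxDim lam ε), Real.exp (score lam μ ς C ε k y) :=
  Finset.sum_pos (fun _ _ => Real.exp_pos _) ⟨1, Finset.mem_Icc.2 ⟨le_rfl, one_le⟩⟩

instance : IsMarkovKernel (hierPosterior lam μ ς C ε) := by
  unfold hierPosterior; infer_instance

/-- The joint law of the observation and the parameter under the hierarchical prior. -/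
theorem compProd_hierPosterior_prod (hε : 0 < ε) (hlam : ∀ j, lam j ≠ 0)
    (hς : ∀ j ≤ maxDim lam ε, 0 < ς j) {A B : Set (ℕ+ → ℝ)} (hA : MeasurableSet A)
    (hB : MeasurableSet B) :
    ((obsKernel lam ε ∘ₘ hierPrior lam μ ς C ε) ⊗ₘ hierPosterior lam μ ς C ε) (B ×ˢ A) =
      ∫⁻ y in B, ∑ m ∈ Finset.Icc 1 (maxDim lam ε),
        ENNReal.ofReal (Real.exp (score lam μ ς C ε m y) /
          ∑ k ∈ Finset.Icc 1 (maxDim lam ε), dimWeight lam ς C ε k) *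
        noise {z | sieveDraw lam μ ς ε m y z ∈ A} ∂(obsKernel lam ε μ) := by
  have hmA : ∀ m, Measurable fun y => noise {z | sieveDraw lam μ ς ε m y z ∈ A} := fun m =>
    measurable_measure_prodMk_left (measurable_sieveDraw lam μ ς ε m hA)
  unfold hierPosterior
  rw [compProd_posterior_eq_map_swap, Measure.map_apply measurable_swap (hB.prod hA),
    Set.preimage_swap_prod, Measure.compProd_apply_prod hA hB, ← lintegral_indicator hA]
  unfold hierPrior
  rw [lintegral_finsetSum_measure, lintegral_finsetSum _ fun m _ => by
    exact (Measurable.ennreal_ofReal (by fun_prop)).mul (hmA m)]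
  refine Finset.sum_congr rfl fun m hm => ?_
  have hm := (Finset.mem_Icc.1 hm).2
  rw [lintegral_smul_measure, lintegral_indicator hA, ← Measure.compProd_apply_prod hA hB,
    ← Set.preimage_swap_prod, ← Measure.map_apply measurable_swap (hB.prod hA),
    sievePrior_compProd_obsKernel μ ς hε hlam m, Measure.compProd_apply_prod hB hA,
    sieveObs_eq_withDensity hε hlam m, setLIntegral_withDensity_eq_setLIntegral_mul _
      (measurable_likelihoodRatio m) (Kernel.measurable_coe _ hA) hB, ← obsKernel_apply,
    ENNReal.smul_def, smul_eq_mul, ← lintegral_const_mul _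
      ((measurable_likelihoodRatio m).mul (Kernel.measurable_coe _ hA))]
  refine lintegral_congr fun y => ?_
  rw [Pi.mul_apply, randomKernel_apply _ (measurable_sieveDraw lam μ ς ε m),
    Measure.map_apply (f := fun z => sieveDraw lam μ ς ε m y z)
      ((measurable_sieveDraw lam μ ς ε m).comp measurable_prodMk_left) hA, ← mul_assoc, ← dimPrior_mul_likelihoodRatio hε fun j hj => hς j (hj.trans hm)]
  rfl

/-- The density is strictly positive, so the law of `Y` at the prior mean is absolutely continuous
with respect to the marginal law. -/
theorem obsKernel_comp_hierPrior (hε : 0 < ε) (hlam : ∀ j, lam j ≠ 0)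
    (hς : ∀ j ≤ maxDim lam ε, 0 < ς j) :
    obsKernel lam ε ∘ₘ hierPrior lam μ ς C ε = (obsKernel lam ε μ).withDensity fun y =>
      ENNReal.ofReal ((∑ m ∈ Finset.Icc 1 (maxDim lam ε), Real.exp (score lam μ ς C ε m y)) /
          ∑ k ∈ Finset.Icc 1 (maxDim lam ε), dimWeight lam ς C ε k) := by
  ext B hB
  have := compProd_hierPosterior_prod (μ := μ) (C := C) hε hlam hς (A := Set.univ) .univ hB
  rw [Measure.compProd_apply_prod hB .univ] at *
  simp only [measure_univ, Set.mem_univ, Set.ofPred_true, mul_one, lintegral_const, one_mul,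
    Measure.restrict_apply .univ, Set.univ_inter] at *
  rw [withDensity_apply _ hB, ‹(obsKernel lam ε ∘ₘ _) B = _›]
  refine lintegral_congr fun y => ?_
  have hZ := (sum_dimWeight_pos (lam := lam) (C := C) hε hς)
  rw [Finset.sum_div, ENNReal.ofReal_sum_of_nonneg fun i _ => by positivity]

theorem obsKernel_absolutelyContinuous (hε : 0 < ε) {θ : ℕ+ → ℝ}
    (hθ : Summable fun j => (lam j * (θ j - μ j)) ^ 2) :
    obsKernel lam ε θ ≪ obsKernel lam ε μ := by
  have hs : 0 < √ε := Real.sqrt_pos.2 hε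
  rw [obsKernel_apply, obsKernel_apply]
  have : Summable fun j => (lam j * (θ j - μ j) / √ε) ^ 2 := by
    simp_rw [div_pow]; exact hθ.div_const _
  have h := (noise_map_add_absolutelyContinuous this).map
    (f := fun z j => lam j * μ j + √ε * z j) (by fun_prop)
  rw [Measure.map_map (by fun_prop) (by fun_prop)] at h
  convert h using 2
  ext z j
  simp only [Function.comp]
  field_simp
  ring

/-- The posterior as an explicit mixture of Gaussian laws. -/
theorem lintegral_hierPosterior (hε : 0 < ε) (hlam : ∀ j, lam j ≠ 0)
    (hς : ∀ j ≤ maxDim lam ε, 0 < ς j) {θ : ℕ+ → ℝ}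
    (hθ : Summable fun j => (lam j * (θ j - μ j)) ^ 2) {A : Set (ℕ+ → ℝ)}
    (hA : MeasurableSet A) :
    ∫⁻ y, hierPosterior lam μ ς C ε y A ∂(obsKernel lam ε θ) =
      ∫⁻ y, ∑ m ∈ Finset.Icc 1 (maxDim lam ε), ENNReal.ofReal (dimPost lam μ ς C ε m y) *
        noise {z | sieveDraw lam μ ς ε m y z ∈ A} ∂(obsKernel lam ε θ) := by
  have hmA : ∀ m, Measurable fun y => noise {z | sieveDraw lam μ ς ε m y z ∈ A} := fun m =>
    measurable_measure_prodMk_left (measurable_sieveDraw lam μ ς ε m hA)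
  have hZ := (sum_dimWeight_pos (lam := lam) (C := C) hε hς)
  have hS := sum_exp_score_pos (lam := lam) (μ := μ) (ς := ς) (C := C) (ε := ε)
  have hpost : Measurable fun y => ∑ m ∈ Finset.Icc 1 (maxDim lam ε),
      ENNReal.ofReal (dimPost lam μ ς C ε m y) * noise {z | sieveDraw lam μ ς ε m y z ∈ A} :=
    Finset.measurable_fun_sum _ fun m _ => (Measurable.ennreal_ofReal (by fun_prop)).mul (hmA m)
  refine lintegral_congr_ae ?_
  -- The identity is proved almost everywhere for the marginal law of `Y` and carried to the law
  -- under `θ` by absolute continuity.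
  refine Measure.AbsolutelyContinuous.ae_eq (ν := obsKernel lam ε ∘ₘ hierPrior lam μ ς C ε) ?_ ?_
  · refine (obsKernel_absolutelyContinuous hε hθ).trans ?_
    rw [obsKernel_comp_hierPrior hε hlam hς]
    refine withDensity_absolutelyContinuous' (Measurable.aemeasurable (by fun_prop))
      (ae_of_all _ fun y => ?_)
    rw [Ne, ENNReal.ofReal_eq_zero, not_le]
    exact div_pos (hS y) hZ
  · refine ae_eq_of_forall_setLIntegral_eq_of_sigmaFinite (Kernel.measurable_coe _ hA) hpost
      fun B hB _ => ?_
    rw [← Measure.compProd_apply_prod hB hA, compProd_hierPosterior_prod hε hlam hς hA hB,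
      obsKernel_comp_hierPrior hε hlam hς, setLIntegral_withDensity_eq_setLIntegral_mul _
        (by fun_prop) hpost hB]
    refine lintegral_congr fun y => ?_
    rw [Pi.mul_apply, Finset.mul_sum]
    refine Finset.sum_congr rfl fun m _ => ?_
    rw [← mul_assoc, ← ENNReal.ofReal_mul (div_pos (hS y) hZ).le]
    congr 2
    unfold dimPost
    have := (hS y).ne'
    field_simp

end

/-! ### Posterior weights of dimensions and Chernoff bounds. -/

section

variable {lam μ : ℕ+ → ℝ} {ς : ℕ+ → ℝ≥0} {C ε : ℝ}

theorem Icc_one_eq_union {k m : ℕ+} (h : k ≤ m) :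
    Finset.Icc 1 m = Finset.Icc 1 k ∪ Finset.Ioc k m := by
  ext j
  simp only [Finset.mem_Icc, Finset.mem_union, Finset.mem_Ioc, one_le, true_and]
  constructor
  · intro hj
    rcases le_or_gt j k with h1 | h1
    exacts [Or.inl h1, Or.inr ⟨h1, hj⟩]
  · rintro (h1 | h1)
    exacts [h1.trans h, h1.2]

theorem sum_Icc_one_eq_add {k m : ℕ+} (h : k ≤ m) (f : ℕ+ → ℝ) :
    ∑ j ∈ Finset.Icc 1 m, f j = ∑ j ∈ Finset.Icc 1 k, f j + ∑ j ∈ Finset.Ioc k m, f j := by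
  rw [Icc_one_eq_union h, Finset.sum_union]
  rw [Finset.disjoint_left]
  intro j hj hj'
  exact absurd (Finset.mem_Icc.1 hj).2 (not_le.2 (Finset.mem_Ioc.1 hj').1)

theorem dimPost_nonneg (m : ℕ+) (y : ℕ+ → ℝ) : 0 ≤ dimPost lam μ ς C ε m y :=
  div_nonneg (Real.exp_pos _).le (sum_exp_score_pos y).le

theorem sum_dimPost (y : ℕ+ → ℝ) :
    ∑ m ∈ Finset.Icc 1 (maxDim lam ε), dimPost lam μ ς C ε m y = 1 := by
  unfold dimPost
  rw [← Finset.sum_div, div_self (sum_exp_score_pos y).ne']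

theorem dimPost_le_one {m : ℕ+} (hm : m ≤ maxDim lam ε) (y : ℕ+ → ℝ) :
    dimPost lam μ ς C ε m y ≤ 1 := by
  rw [← sum_dimPost (lam := lam) (μ := μ) (ς := ς) (C := C) (ε := ε) y]
  exact Finset.single_le_sum (f := fun m => dimPost lam μ ς C ε m y)
    (fun i _ => dimPost_nonneg i y) (Finset.mem_Icc.2 ⟨one_le, hm⟩)

theorem dimPost_le_exp {k : ℕ+} (hk : k ≤ maxDim lam ε) (m : ℕ+) (y : ℕ+ → ℝ) :
    dimPost lam μ ς C ε m y ≤ Real.exp (score lam μ ς C ε m y - score lam μ ς C ε k y) := by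
  unfold dimPost
  rw [Real.exp_sub]
  gcongr
  exact Finset.single_le_sum (f := fun k => Real.exp (score lam μ ς C ε k y))
    (fun i _ => (Real.exp_pos _).le) (Finset.mem_Icc.2 ⟨one_le, hk⟩)

/-- A weight is at most `1`, so the exponent may be halved. The squares of the Gaussians then carry
a coefficient at most `1/4` instead of up to `1/2`, where the Laplace transform is infinite. -/
theorem dimPost_le_exp_half {k m : ℕ+} (hk : k ≤ maxDim lam ε) (hm : m ≤ maxDim lam ε)
    (y : ℕ+ → ℝ) :
    dimPost lam μ ς C ε m y ≤
      Real.exp ((score lam μ ς C ε m y - score lam μ ς C ε k y) / 2) := by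
  rcases le_total 0 (score lam μ ς C ε m y - score lam μ ς C ε k y) with h | h
  · exact (dimPost_le_one hm y).trans (Real.one_le_exp (by linarith))
  · exact (dimPost_le_exp hk m y).trans (Real.exp_le_exp.2 (by linarith))

theorem lintegral_obsKernel {θ : ℕ+ → ℝ} {f : (ℕ+ → ℝ) → ℝ≥0∞} (hf : Measurable f) :
    ∫⁻ y, f y ∂(obsKernel lam ε θ) = ∫⁻ z, f (fun j => lam j * θ j + √ε * z j) ∂noise := by
  rw [obsKernel_apply, lintegral_map hf (by fun_prop)]

theorem stdObs_obs (hε : 0 < ε) (θ z : ℕ+ → ℝ) (j : ℕ+) :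
    stdObs lam μ ε (fun j => lam j * θ j + √ε * z j) j =
      lam j * (θ j - μ j) / √ε + z j := by
  have hs : 0 < √ε := Real.sqrt_pos.2 hε
  unfold stdObs
  field_simp
  ring

theorem lintegral_exp_sum_noise (s : Finset ℕ+) (g : ℕ+ → ℝ → ℝ) (hg : ∀ j, Measurable (g j)) :
    ∫⁻ z, ENNReal.ofReal (Real.exp (∑ j ∈ s, g j (z j))) ∂noise =
      ∏ j ∈ s, ∫⁻ x, ENNReal.ofReal (Real.exp (g j x)) ∂(gaussianReal 0 1) := by
  simp_rw [Real.exp_sum, ENNReal.ofReal_prod_of_nonneg fun j _ => (Real.exp_pos _).le]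
  exact lintegral_prod_infinitePi _ s (fun j x => ENNReal.ofReal (Real.exp (g j x)))
    fun j => by fun_prop

theorem lintegral_exp_sum_noise_le {s : Finset ℕ+} {g : ℕ+ → ℝ → ℝ} {c : ℕ+ → ℝ}
    (hg : ∀ j, Measurable (g j))
    (h : ∀ j ∈ s, ∫⁻ x, ENNReal.ofReal (Real.exp (g j x)) ∂(gaussianReal 0 1) ≤
      ENNReal.ofReal (Real.exp (c j))) :
    ∫⁻ z, ENNReal.ofReal (Real.exp (∑ j ∈ s, g j (z j))) ∂noise ≤
      ENNReal.ofReal (Real.exp (∑ j ∈ s, c j)) := by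
  rw [lintegral_exp_sum_noise s g hg, Real.exp_sum,
    ENNReal.ofReal_prod_of_nonneg fun j _ => (Real.exp_pos _).le]
  exact Finset.prod_le_prod' h

theorem lintegral_exp_add_const (ν : Measure ℝ) (f : ℝ → ℝ) (b : ℝ) :
    ∫⁻ x, ENNReal.ofReal (Real.exp (f x + b)) ∂ν =
      (∫⁻ x, ENNReal.ofReal (Real.exp (f x)) ∂ν) * ENNReal.ofReal (Real.exp b) := by
  simp_rw [Real.exp_add, ENNReal.ofReal_mul (Real.exp_pos _).le]
  rw [lintegral_mul_const' _ _ ENNReal.ofReal_ne_top]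

/-- Dimensions below `k` are unlikely under the posterior if the signal between them is large. -/
theorem lintegral_dimPost_le_of_lt (hε : 0 < ε) {θ : ℕ+ → ℝ} {k m : ℕ+}
    (hk : k ≤ maxDim lam ε) (hmk : m < k) {q : ℝ} (hq : 0 ≤ q)
    (hw : ∀ j ≤ k, q ≤ shrink lam ς ε j ∧ shrink lam ς ε j ≤ 1) :
    ∫⁻ y, ENNReal.ofReal (dimPost lam μ ς C ε m y) ∂(obsKernel lam ε θ) ≤
      ENNReal.ofReal (Real.exp (∑ j ∈ Finset.Ioc m k,
        (3 * C / 2 - q / 4 * (lam j * (θ j - μ j) / √ε) ^ 2))) := by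
  rw [lintegral_obsKernel (by fun_prop)]
  calc _ ≤ ∫⁻ z, ENNReal.ofReal (Real.exp (∑ j ∈ Finset.Ioc m k,
        (-(shrink lam ς ε j / 2) * (lam j * (θ j - μ j) / √ε + z j) ^ 2 + 3 * C / 2))) ∂noise := by
        refine lintegral_mono fun z => ENNReal.ofReal_le_ofReal ((dimPost_le_exp hk m _).trans
          (le_of_eq ?_))
        congr 1
        unfold score
        rw [sum_Icc_one_eq_add hmk.le, sub_add_cancel_left, ← Finset.sum_neg_distrib]
        refine Finset.sum_congr rfl fun j _ => ?_
        rw [stdObs_obs hε]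
        ring
    _ ≤ _ := by
        refine lintegral_exp_sum_noise_le (g := fun j x =>
          -(shrink lam ς ε j / 2) * (lam j * (θ j - μ j) / √ε + x) ^ 2 + 3 * C / 2)
          (fun j => by fun_prop) fun j hj => ?_
        obtain ⟨h1, h2⟩ := hw j (Finset.mem_Ioc.1 hj).2
        have h0 := hq.trans h1
        rw [lintegral_exp_add_const]
        refine (mul_le_mul_left (lintegral_exp_neg_mul_sq_gaussian_le h0) _).trans ?_
        rw [← ENNReal.ofReal_mul (Real.exp_pos _).le, ← Real.exp_add]
        refine ENNReal.ofReal_le_ofReal (Real.exp_le_exp.2 ?_)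
        set δ := lam j * (θ j - μ j) / √ε
        set w := shrink lam ς ε j
        -- Here `q ≤ w ≤ 1`, hence `2 * (1 + w) ≤ 4`.
        have : q / 4 * δ ^ 2 ≤ w * δ ^ 2 / (2 * (1 + w)) := by
          rw [le_div_iff₀ (by linarith)]
          have : 0 ≤ δ ^ 2 := sq_nonneg _
          nlinarith [mul_nonneg hq this, mul_nonneg (mul_nonneg hq this) (sub_nonneg.2 h2),
            mul_nonneg this (sub_nonneg.2 h1)]
        linarith

/-- Dimensions above `k` are unlikely under the posterior if the signal between them is small. -/
theorem lintegral_dimPost_le_of_gt (hε : 0 < ε) (hC : 1 ≤ C) {θ : ℕ+ → ℝ} {k m : ℕ+}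
    (hm : m ≤ maxDim lam ε) (hkm : k < m) (hw : ∀ j ≤ m, shrink lam ς ε j ≤ 1) :
    ∫⁻ y, ENNReal.ofReal (dimPost lam μ ς C ε m y) ∂(obsKernel lam ε θ) ≤
      ENNReal.ofReal (Real.exp (∑ j ∈ Finset.Ioc k m,
        ((lam j * (θ j - μ j) / √ε) ^ 2 / 2 - C / 4))) := by
  rw [lintegral_obsKernel (by fun_prop)]
  calc _ ≤ ∫⁻ z, ENNReal.ofReal (Real.exp (∑ j ∈ Finset.Ioc k m,
        (1 / 4 * (lam j * (θ j - μ j) / √ε + 1 * z j) ^ 2 + -(3 * C / 4)))) ∂noise := by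
        refine lintegral_mono fun z => ENNReal.ofReal_le_ofReal
          ((dimPost_le_exp_half (hkm.le.trans hm) hm _).trans (Real.exp_le_exp.2 ?_))
        unfold score
        rw [sum_Icc_one_eq_add hkm.le, add_sub_cancel_left, Finset.sum_div]
        refine Finset.sum_le_sum fun j hj => ?_
        rw [stdObs_obs hε]
        have := mul_le_mul_of_nonneg_right (hw j (Finset.mem_Ioc.1 hj).2)
          (sq_nonneg (lam j * (θ j - μ j) / √ε + z j))
        linarith
    _ ≤ _ := by
        refine lintegral_exp_sum_noise_le (g := fun j x =>
          1 / 4 * (lam j * (θ j - μ j) / √ε + 1 * x) ^ 2 + -(3 * C / 4))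
          (fun j => by fun_prop) fun j hj => ?_
        rw [lintegral_exp_add_const]
        refine (mul_le_mul_left (lintegral_exp_mul_sq_gaussian_le (by norm_num)
          (by norm_num)) _).trans ?_
        rw [← ENNReal.ofReal_mul (Real.exp_pos _).le, ← Real.exp_add]
        refine ENNReal.ofReal_le_ofReal (Real.exp_le_exp.2 ?_)
        -- The noise contributes `1/2` per coordinate and the halved penalty `3C/4`; as `C ≥ 1`, a
        -- net `-C/4` remains.
        linarith

theorem noise_lt_le_lintegral_exp {S : (ℕ+ → ℝ) → ℝ} (hS : Measurable S) (t τ : ℝ) (hτ : 0 ≤ τ) :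
    noise {z | t < S z} ≤
      ENNReal.ofReal (Real.exp (-(τ * t))) * ∫⁻ z, ENNReal.ofReal (Real.exp (τ * S z)) ∂noise := by
  rw [← lintegral_const_mul _ (by fun_prop), ← lintegral_indicator_one
    (measurableSet_lt measurable_const hS)]
  refine lintegral_mono fun z => ?_
  by_cases h : t < S z
  · rw [Set.indicator_of_mem (by exact h), ← ENNReal.ofReal_mul (Real.exp_pos _).le,
      ← Real.exp_add, Pi.one_apply, ← ENNReal.ofReal_one]
    exact ENNReal.ofReal_le_ofReal (Real.one_le_exp (by nlinarith))
  · rw [Set.indicator_of_notMem (by exact h)]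
    exact zero_le

/-- The part of the squared error of a posterior draw in the first `n` coordinates. -/
def drawError (lam μ : ℕ+ → ℝ) (ς : ℕ+ → ℝ≥0) (ε : ℝ) (θ : ℕ+ → ℝ) (n : ℕ+) (y z : ℕ+ → ℝ) : ℝ :=
  ∑ j ∈ Finset.Icc 1 n, (sieveDraw lam μ ς ε n y z j - θ j) ^ 2

theorem measurable_drawError (θ : ℕ+ → ℝ) (n : ℕ+) :
    Measurable fun p : (ℕ+ → ℝ) × (ℕ+ → ℝ) => drawError lam μ ς ε θ n p.1 p.2 := by
  have := measurable_sieveDraw lam μ ς ε n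
  unfold drawError
  exact Finset.measurable_fun_sum _ fun j _ =>
    (((measurable_pi_apply j).comp this).sub_const _).pow_const 2

/-- Chernoff bound for a sum of squares of independent Gaussian variables. -/
theorem lintegral_noise_sum_sq_le {s : Finset ℕ+} {V : ℝ} (t : ℝ) (hV : 0 < V) (α : ℕ+ → ℝ)
    {β u : ℕ+ → ℝ} (hβ : ∀ j ∈ s, β j ^ 2 ≤ V) (hu : ∀ j ∈ s, u j ^ 2 ≤ V) :
    ∫⁻ ξ, noise {z | t < ∑ j ∈ s, (α j + β j * ξ j + u j * z j) ^ 2} ∂noise ≤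
      ENNReal.ofReal (Real.exp (-(t / (8 * V)) + ∑ j ∈ s, (3 / 4 + α j ^ 2 / (2 * V)))) := by
  have hinner : ∀ ξ : ℕ+ → ℝ, noise {z | t < ∑ j ∈ s, (α j + β j * ξ j + u j * z j) ^ 2} ≤
      ENNReal.ofReal (Real.exp (-(t / (8 * V)))) * ENNReal.ofReal (Real.exp (∑ j ∈ s,
        (1 / (4 * V) * (α j + β j * ξ j) ^ 2 + 1 / 4))) := by
    intro ξ
    -- Integrating out `z` doubles the coefficient of the remaining square to `1 / (4V)`, the
    -- largest value admissible for integrating out `ξ`; hence the choice `1 / (8V)`.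
    refine (noise_lt_le_lintegral_exp (by fun_prop) t (1 / (8 * V)) (by positivity)).trans ?_
    rw [show 1 / (8 * V) * t = t / (8 * V) by ring]
    refine mul_le_mul_right ?_ _
    simp_rw [Finset.mul_sum]
    refine lintegral_exp_sum_noise_le
      (g := fun j x => 1 / (8 * V) * (α j + β j * ξ j + u j * x) ^ 2) (fun j => by fun_prop)
      fun j hj => ?_
    have h8 : 1 / (8 * V) * u j ^ 2 ≤ 1 / 8 := by
      rw [one_div_mul_eq_div, div_le_div_iff₀ (by positivity) (by norm_num)]; linarith [hu j hj]
    refine (lintegral_exp_mul_sq_gaussian_le (by positivity) (by linarith)).trans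
      (ENNReal.ofReal_le_ofReal (Real.exp_le_exp.2 ?_))
    have e : 1 / (4 * V) = 2 * (1 / (8 * V)) := by field_simp; norm_num
    rw [e]
    linarith
  refine (lintegral_mono hinner).trans ?_
  rw [lintegral_const_mul _ (by fun_prop), Real.exp_add,
    ENNReal.ofReal_mul (Real.exp_pos _).le]
  refine mul_le_mul_right ?_ _
  refine lintegral_exp_sum_noise_le (g := fun j x =>
    (1 / (4 * V) * (α j + β j * x) ^ 2 + 1 / 4)) (fun j => by fun_prop) fun j hj => ?_
  have h8 : 1 / (4 * V) * β j ^ 2 ≤ 1 / 4 := by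
    rw [one_div_mul_eq_div, div_le_div_iff₀ (by positivity) (by norm_num)]; linarith [hβ j hj]
  rw [lintegral_exp_add_const]
  refine (mul_le_mul_left (lintegral_exp_mul_sq_gaussian_le (by positivity)
    (by linarith)) _).trans ?_
  rw [← ENNReal.ofReal_mul (Real.exp_pos _).le, ← Real.exp_add]
  refine ENNReal.ofReal_le_ofReal (Real.exp_le_exp.2 ?_)
  have e : 2 * (1 / (4 * V)) * α j ^ 2 = α j ^ 2 / (2 * V) := by field_simp; norm_num
  rw [e]
  linarith

/-- Chernoff bound for the squared error of a posterior draw. -/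
theorem lintegral_noise_drawError_le (hε : 0 < ε) (hlam : ∀ j, lam j ≠ 0) {θ : ℕ+ → ℝ} {n : ℕ+}
    {V : ℝ} (t : ℝ) (hV : 0 < V) (hΛ : ∀ j ≤ n, ε * ev lam j ≤ V)
    (hw : ∀ j ≤ n, 0 ≤ shrink lam ς ε j ∧ shrink lam ς ε j ≤ 1) :
    ∫⁻ y, noise {z | t < drawError lam μ ς ε θ n y z} ∂(obsKernel lam ε θ) ≤
      ENNReal.ofReal (Real.exp (-(t / (8 * V)) + ∑ j ∈ Finset.Icc 1 n,
        (3 / 4 + ((1 - shrink lam ς ε j) * (θ j - μ j)) ^ 2 / (2 * V)))) := by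
  have hD := measurable_drawError (lam := lam) (μ := μ) (ς := ς) (ε := ε) θ n
  have hev : ∀ j, 0 ≤ ev lam j := fun j => by unfold ev; positivity
  have hmeas : Measurable fun y => noise {z | t < drawError lam μ ς ε θ n y z} :=
    measurable_measure_prodMk_left (measurableSet_lt measurable_const hD)
  rw [lintegral_obsKernel hmeas]
  -- The error splits into shrinkage bias, observation noise and posterior noise.
  have hdraw : ∀ ξ z : ℕ+ → ℝ, drawError lam μ ς ε θ n (fun j => lam j * θ j + √ε * ξ j) z =
      ∑ j ∈ Finset.Icc 1 n, ((1 - shrink lam ς ε j) * (μ j - θ j) +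
        shrink lam ς ε j * √ε / lam j * ξ j +
        √(shrink lam ς ε j * (ε * ev lam j)) * z j) ^ 2 := by
    intro ξ z
    refine Finset.sum_congr rfl fun j hj => ?_
    have hl := hlam j
    unfold sieveDraw
    simp only [(Finset.mem_Icc.1 hj).2, if_true]
    generalize √(shrink lam ς ε j * (ε * ev lam j)) = a
    congr 1
    field_simp
    ring
  simp_rw [hdraw]
  refine (lintegral_noise_sum_sq_le t hV (fun j => (1 - shrink lam ς ε j) * (μ j - θ j))
    (fun j hj => ?_) (fun j hj => ?_)).trans (le_of_eq ?_)
  · have hj := (Finset.mem_Icc.1 hj).2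
    have hl := hlam j
    rw [div_pow, mul_pow, Real.sq_sqrt hε.le, show shrink lam ς ε j ^ 2 * ε / lam j ^ 2 =
      shrink lam ς ε j ^ 2 * (ε * ev lam j) by unfold ev; field_simp]
    exact (mul_le_of_le_one_left (mul_nonneg hε.le (hev j))
      (pow_le_one₀ (hw j hj).1 (hw j hj).2)).trans (hΛ j hj)
  · have hj := (Finset.mem_Icc.1 hj).2
    rw [Real.sq_sqrt (mul_nonneg (hw j hj).1 (mul_nonneg hε.le (hev j)))]
    exact (mul_le_of_le_one_left (mul_nonneg hε.le (hev j)) (hw j hj).2).trans (hΛ j hj)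
  · congr 3
    refine Finset.sum_congr rfl fun j _ => ?_
    rw [mul_pow, mul_pow, ← neg_sq (μ j - θ j), neg_sub]

/-- The squared bias `∑_{j > m} xⱼ²` of a truncation at `m`. -/
def bias (x : ℕ+ → ℝ) (m : ℕ+) : ℝ := ∑' j, (Set.Ioi m).indicator (fun j => x j ^ 2) j

/-- Draws in dimensions `m ≤ n` with the same noise coincide up to coordinate `m`. Thus one
variable, the error in dimension `n`, serves all `m ≤ n` without a union bound. -/
theorem normSq_sieveDraw_le {θ : ℕ+ → ℝ} (hθ : Summable fun j => (θ j - μ j) ^ 2) {m n : ℕ+}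
    (hmn : m ≤ n) (y z : ℕ+ → ℝ) :
    normSq (sieveDraw lam μ ς ε m y z - θ) ≤
      ENNReal.ofReal (drawError lam μ ς ε θ n y z + bias (fun j => θ j - μ j) m) := by
  have h1 : ∀ j, ENNReal.ofReal ((sieveDraw lam μ ς ε m y z - θ) j ^ 2) ≤
      (if j ∈ Finset.Icc 1 n then
        ENNReal.ofReal ((sieveDraw lam μ ς ε n y z j - θ j) ^ 2) else 0) +
      ENNReal.ofReal ((Set.Ioi m).indicator (fun j => (θ j - μ j) ^ 2) j) := by
    intro j
    rcases le_or_gt j m with h | h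
    · have hn : j ∈ Finset.Icc 1 n := Finset.mem_Icc.2 ⟨one_le, h.trans hmn⟩
      rw [if_pos hn]
      refine le_add_right (le_of_eq ?_)
      simp [sieveDraw, h, h.trans hmn]
    · refine le_add_left (le_of_eq ?_)
      rw [Set.indicator_of_mem (by exact h)]
      simp only [Pi.sub_apply, sieveDraw, not_le.2 h, if_false]
      congr 1; ring
  unfold normSq
  refine (ENNReal.tsum_le_tsum h1).trans ?_
  rw [ENNReal.tsum_add]
  have hnn : ∀ j, 0 ≤ (Set.Ioi m).indicator (fun j => (θ j - μ j) ^ 2) j :=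
    fun j => Set.indicator_nonneg (fun _ _ => sq_nonneg _) j
  unfold drawError bias
  rw [ENNReal.ofReal_add (Finset.sum_nonneg fun j _ => sq_nonneg _) (tsum_nonneg hnn),
    ENNReal.ofReal_tsum_of_nonneg hnn (hθ.indicator _),
    ENNReal.ofReal_sum_of_nonneg fun j _ => sq_nonneg _]
  gcongr
  rw [tsum_eq_sum (s := Finset.Icc 1 n) fun j hj => by simp only [hj, if_false]]
  exact (Finset.sum_congr rfl fun j hj => by rw [if_pos hj]).le

theorem measurable_normSq_sub (θ : ℕ+ → ℝ) : Measurable fun x : ℕ+ → ℝ => normSq (x - θ) := by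
  unfold normSq
  simp only [Pi.sub_apply]
  fun_prop

/-- Posterior mass outside a ball, when each dimension is either unlikely or has small bias. -/
theorem le_expectedPostMass (hε : 0 < ε) (hlam : ∀ j, lam j ≠ 0)
    (hς : ∀ j ≤ maxDim lam ε, 0 < ς j) {θ : ℕ+ → ℝ}
    (hθ : Summable fun j => (lam j * (θ j - μ j)) ^ 2) (hθ' : Summable fun j => (θ j - μ j) ^ 2)
    {n : ℕ+} {t t' β E E' : ℝ} (ht : t' + β ≤ t)
    (hm : ∀ m ≤ maxDim lam ε,
      (∫⁻ y, ENNReal.ofReal (dimPost lam μ ς C ε m y) ∂(obsKernel lam ε θ) ≤ ENNReal.ofReal E) ∨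
        (m ≤ n ∧ bias (fun j => θ j - μ j) m ≤ β))
    (hE' : ∫⁻ y, noise {z | t' < drawError lam μ ς ε θ n y z} ∂(obsKernel lam ε θ) ≤
      ENNReal.ofReal E') :
    1 ≤ expectedPostMass lam μ ς C ε θ t +
      ((maxDim lam ε : ℕ) * ENNReal.ofReal E + ENNReal.ofReal E') := by
  classical
  have hA : MeasurableSet {x : ℕ+ → ℝ | normSq (x - θ) ≤ ENNReal.ofReal t} :=
    measurableSet_le (measurable_normSq_sub θ) measurable_const
  set A := {x : ℕ+ → ℝ | normSq (x - θ) ≤ ENNReal.ofReal t} with hAdef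
  have h1 : expectedPostMass lam μ ς C ε θ t +
      ∫⁻ y, hierPosterior lam μ ς C ε y Aᶜ ∂(obsKernel lam ε θ) = 1 := by
    unfold expectedPostMass
    rw [← lintegral_add_left (Kernel.measurable_coe _ hA)]
    simp_rw [measure_add_measure_compl hA, measure_univ]
    simp
  rw [← h1]
  gcongr
  rw [lintegral_hierPosterior hε hlam hς hθ hA.compl]
  set h : (ℕ+ → ℝ) → ℝ≥0∞ := fun y => noise {z | t' < drawError lam μ ς ε θ n y z} with hh
  set s := Finset.Icc 1 (maxDim lam ε) with hs
  set p : ℕ+ → Prop := fun m =>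
    ∫⁻ y, ENNReal.ofReal (dimPost lam μ ς C ε m y) ∂(obsKernel lam ε θ) ≤ ENNReal.ofReal E with hp
  have hpt : ∀ y, ∑ m ∈ s, ENNReal.ofReal (dimPost lam μ ς C ε m y) *
      noise {z | sieveDraw lam μ ς ε m y z ∈ Aᶜ} ≤
      ∑ m ∈ s with p m, ENNReal.ofReal (dimPost lam μ ς C ε m y) + h y := by
    intro y
    rw [← Finset.sum_filter_add_sum_filter_not s p]
    gcongr with m hm1
    · exact mul_le_of_le_one_right' prob_le_one
    -- For the dimensions of small bias the event forces `t' < drawError`, independently of `m`, and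
    -- the posterior weights sum to `1`.
    · calc _ ≤ ∑ m ∈ s with ¬ p m, ENNReal.ofReal (dimPost lam μ ς C ε m y) * h y := by
            refine Finset.sum_le_sum fun m hm1 => ?_
            obtain ⟨hm1, hm2⟩ := Finset.mem_filter.1 hm1
            obtain ⟨hmn, hb⟩ := (hm m (Finset.mem_Icc.1 hm1).2).resolve_left hm2
            refine mul_le_mul_right (measure_mono fun z hz => ?_) _
            by_contra hlt
            refine hz ((normSq_sieveDraw_le hθ' hmn y z).trans (ENNReal.ofReal_le_ofReal ?_))
            have : drawError lam μ ς ε θ n y z ≤ t' := not_lt.1 hlt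
            linarith
        _ ≤ ∑ m ∈ s, ENNReal.ofReal (dimPost lam μ ς C ε m y) * h y :=
            Finset.sum_le_sum_of_subset (Finset.filter_subset _ _)
        _ = h y := by
            rw [← Finset.sum_mul, ← ENNReal.ofReal_sum_of_nonneg fun i _ => dimPost_nonneg i y,
              sum_dimPost, ENNReal.ofReal_one, one_mul]
  refine (lintegral_mono hpt).trans ?_
  rw [lintegral_add_left (Finset.measurable_fun_sum _ fun m _ => by fun_prop),
    lintegral_finsetSum _ fun m _ => by fun_prop]
  gcongr
  calc _ ≤ ∑ m ∈ s with p m, ENNReal.ofReal E :=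
        Finset.sum_le_sum fun m hm => (Finset.mem_filter.1 hm).2
    _ ≤ ∑ m ∈ s, ENNReal.ofReal E := Finset.sum_le_sum_of_subset (Finset.filter_subset _ _)
    _ = _ := by
        rw [Finset.sum_const, nsmul_eq_mul]
        congr 2
        simp [hs]

end

/-! ### Minimax dimension and rate, bias on the ellipsoid, prior variances. -/

section

variable {lam μ γ : ℕ+ → ℝ} {ς : ℕ+ → ℝ≥0} {C L ε ε₀ d r : ℝ}

theorem ev_pos (hlam : ∀ j, lam j ≠ 0) (j : ℕ+) : 0 < ev lam j := by
  have := hlam j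
  unfold ev; positivity

theorem ev_le_evMax {j m : ℕ+} (h : j ≤ m) : ev lam j ≤ evMax lam m :=
  Finset.le_sup' (ev lam) (Finset.mem_Icc.2 ⟨one_le, h⟩)

theorem evMax_pos (hlam : ∀ j, lam j ≠ 0) (m : ℕ+) : 0 < evMax lam m :=
  (ev_pos hlam m).trans_le (ev_le_evMax le_rfl)

theorem mul_evMean (m : ℕ+) : (m : ℝ) * evMean lam m = ∑ j ∈ Finset.Icc 1 m, ev lam j := by
  unfold evMean
  rw [← mul_assoc, mul_inv_cancel₀ (by positivity), one_mul]

theorem evMean_pos (hlam : ∀ j, lam j ≠ 0) (m : ℕ+) : 0 < evMean lam m := by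
  refine mul_pos (by positivity) (Finset.sum_pos (fun j _ => ev_pos hlam j)
    ⟨1, Finset.mem_Icc.2 ⟨le_rfl, one_le⟩⟩)

namespace OperatorCond

theorem evMean_le_evMax (hlam : ∀ j, lam j ≠ 0) (hop : OperatorCond lam C L) (m : ℕ+) :
    evMean lam m ≤ evMax lam m :=
  (one_le_div (evMean_pos hlam m)).1 (hop.one_le_ratio m)

theorem evMax_le_mul_evMean (hlam : ∀ j, lam j ≠ 0) (hop : OperatorCond lam C L) (m : ℕ+) :
    evMax lam m ≤ L * evMean lam m :=
  (div_le_iff₀ (evMean_pos hlam m)).1 (hop.ratio_le m)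

theorem sq_mul_evMax_le (hlam : ∀ j, lam j ≠ 0) (hop : OperatorCond lam C L) {k j : ℕ+}
    (h : k < j) : lam j ^ 2 * evMax lam k ≤ C := by
  obtain ⟨i, hi, he⟩ := Finset.exists_mem_eq_sup' ⟨1, Finset.mem_Icc.2 ⟨le_rfl, one_le⟩⟩ (ev lam)
    (s := Finset.Icc 1 k)
  unfold evMax
  rw [he]
  have := hop.tail_le k j i h (Finset.mem_Icc.1 hi).2
  have h0 := hlam i
  unfold ev
  rw [← div_eq_mul_inv, div_le_iff₀ (by positivity)]
  exact this

/-- The tail condition bounds `λ`, hence keeps `Λ` away from zero: the variance term grows at least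
linearly in the dimension. -/
theorem ev_one_le (hlam : ∀ j, lam j ≠ 0) (hop : OperatorCond lam C L) (hC : 1 ≤ C) (j : ℕ+) :
    ev lam 1 / C ≤ ev lam j := by
  rw [div_le_iff₀ (by linarith)]
  rcases (one_le : (1 : ℕ+) ≤ j).eq_or_lt with h | h
  · rw [← h]
    exact le_mul_of_one_le_right (ev_pos hlam 1).le hC
  · have h1 := hop.tail_le 1 j 1 h le_rfl
    have := hlam 1
    have := hlam j
    unfold ev
    rw [inv_eq_one_div, ← div_eq_inv_mul, div_le_div_iff₀ (by positivity) (by positivity)]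
    linarith

theorem mul_ev_one_le (hlam : ∀ j, lam j ≠ 0) (hop : OperatorCond lam C L) (hC : 1 ≤ C) (m : ℕ+) :
    m * (ev lam 1 / C) ≤ m * evMean lam m := by
  rw [mul_evMean]
  have := Finset.card_nsmul_le_sum (Finset.Icc 1 m) (ev lam) (ev lam 1 / C)
    fun j _ => hop.ev_one_le hlam hC j
  rw [nsmul_eq_mul] at this
  simpa using this

end OperatorCond

theorem argmin_spec {f : ℕ+ → ℝ} (h : ∃ m, ∀ k, f m ≤ f k) (k : ℕ+) : f (argmin f) ≤ f k := by
  unfold argmin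
  rw [dif_pos h]
  classical
  exact PNat.find_spec h k

theorem exists_forall_le_of_tendsto_atTop {f : ℕ+ → ℝ} (h : Tendsto f atTop atTop) :
    ∃ m, ∀ k, f m ≤ f k := by
  obtain ⟨N, hN⟩ := (h.eventually_ge_atTop (f 1)).exists_forall_of_atTop
  obtain ⟨m, hm, hmin⟩ := Finset.exists_min_image (Finset.Icc 1 N) f
    ⟨1, Finset.mem_Icc.2 ⟨le_rfl, one_le⟩⟩
  refine ⟨m, fun k => ?_⟩
  rcases le_total k N with hk | hk
  · exact hmin k (Finset.mem_Icc.2 ⟨one_le, hk⟩)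
  · exact (hmin 1 (Finset.mem_Icc.2 ⟨le_rfl, one_le⟩)).trans (hN k hk)

theorem tendsto_pnat_cast_atTop : Tendsto (fun m : ℕ+ => (m : ℝ)) atTop atTop :=
  tendsto_natCast_atTop_atTop.comp tendsto_PNat_val_atTop_atTop

/-- Linear growth of the variance term guarantees a minimiser, so the default value in `argmin` does
not occur. -/
theorem minimaxRate_le (hlam : ∀ j, lam j ≠ 0) (hop : OperatorCond lam C L) (hC : 1 ≤ C)
    (hε : 0 < ε) (k : ℕ+) : minimaxRate γ lam ε ≤ max (γ k) (ε * k * evMean lam k) := by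
  refine argmin_spec (f := fun m => max (γ m) (ε * m * evMean lam m))
    (exists_forall_le_of_tendsto_atTop ?_) k
  have h1 : 0 < ε * (ev lam 1 / C) := mul_pos hε (div_pos (ev_pos hlam 1) (by linarith))
  refine tendsto_atTop_mono (fun m => ?_) (tendsto_pnat_cast_atTop.const_mul_atTop h1)
  refine le_trans ?_ (le_max_right _ _)
  have := mul_le_mul_of_nonneg_left (hop.mul_ev_one_le hlam hC m) hε.le
  linarith

theorem minimaxRate_pos (hγ : ∀ j, 0 < γ j) (ε : ℝ) : 0 < minimaxRate γ lam ε :=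
  (hγ _).trans_le (le_max_left _ _)

theorem tendsto_minimaxRate (hlam : ∀ j, lam j ≠ 0) (hop : OperatorCond lam C L) (hC : 1 ≤ C)
    (hγ : ∀ j, 0 < γ j) (hγ_lim : Tendsto γ atTop (𝓝 0)) :
    Tendsto (minimaxRate γ lam) (𝓝[>] 0) (𝓝 0) := by
  rw [tendsto_order]
  refine ⟨fun a ha => Eventually.of_forall fun ε => ha.trans (minimaxRate_pos hγ ε),
    fun a ha => ?_⟩
  obtain ⟨k, hk⟩ := (hγ_lim.eventually_lt_const ha).exists
  have h1 : Tendsto (fun ε : ℝ => ε * k * evMean lam k) (𝓝[>] 0) (𝓝 0) := by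
    have : Continuous fun ε : ℝ => ε * k * evMean lam k := by fun_prop
    simpa using (this.tendsto 0).mono_left nhdsWithin_le_nhds
  filter_upwards [h1.eventually_lt_const ha, self_mem_nhdsWithin] with ε h2 hε
  exact (minimaxRate_le hlam hop hC hε k).trans_lt (max_lt hk h2)

/-- The rate dominates `γ` at the minimax dimension; since it tends to zero while every `γ N` is
positive, the dimension must pass every `N`. -/
theorem tendsto_minimaxDim (hlam : ∀ j, lam j ≠ 0) (hop : OperatorCond lam C L) (hC : 1 ≤ C)
    (hγ : ∀ j, 0 < γ j) (hγ_anti : Antitone γ) (hγ_lim : Tendsto γ atTop (𝓝 0)) :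
    Tendsto (minimaxDim γ lam) (𝓝[>] 0) atTop := by
  rw [tendsto_atTop]
  intro N
  filter_upwards [(tendsto_minimaxRate hlam hop hC hγ hγ_lim).eventually_lt_const (hγ N)] with ε h
  by_contra hlt
  have h1 := hγ_anti (not_le.1 hlt).le
  have h2 : γ (minimaxDim γ lam ε) ≤ minimaxRate γ lam ε := le_max_left _ _
  linarith

theorem le_maxDim {k : ℕ+} (h1 : ε * k ≤ 1) (h2 : ε * evMax lam k ≤ ev lam 1) (hε : 0 < ε) :
    k ≤ maxDim lam ε := by
  classical
  unfold maxDim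
  have hk : (k : ℕ) ≤ ⌊ε⁻¹⌋₊ := by
    apply Nat.le_floor
    rw [← one_div, le_div_iff₀ hε]
    linarith
  have hk' : k ≤ (⌊ε⁻¹⌋₊).toPNat' := by
    rw [← PNat.coe_le_coe, Nat.toPNat'_coe, if_pos (k.pos.trans_le hk)]
    exact hk
  exact Finset.le_sup (f := id) (Finset.mem_filter.2 ⟨Finset.mem_Icc.2 ⟨one_le, hk'⟩, h2⟩)

/-- Both constraints defining `G_ε` hold at `k` once the rate is small: `ε k Λ₁ / C` is at most the
rate, and `ε Λ₍ₖ₎` at most `L` times the rate. -/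
theorem eventually_minimaxDim_le_maxDim (hlam : ∀ j, lam j ≠ 0) (hop : OperatorCond lam C L)
    (hC : 1 ≤ C) (hL : 1 ≤ L) (hγ : ∀ j, 0 < γ j) (hγ_lim : Tendsto γ atTop (𝓝 0)) :
    ∀ᶠ ε in 𝓝[>] 0, minimaxDim γ lam ε ≤ maxDim lam ε := by
  have hR := tendsto_minimaxRate hlam hop hC hγ hγ_lim
  have h1 := ev_pos hlam 1
  filter_upwards [hR.eventually_lt_const (div_pos h1 (by linarith : 0 < C)),
    hR.eventually_lt_const (div_pos h1 (by linarith : 0 < L)), self_mem_nhdsWithin] with ε ha hb hε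
  have hε : 0 < ε := hε
  set k := minimaxDim γ lam ε
  have hS : ε * k * evMean lam k ≤ minimaxRate γ lam ε := le_max_right _ _
  have hk1 : (1 : ℝ) ≤ k := by exact_mod_cast k.pos
  refine le_maxDim ?_ ?_ hε
  · have := mul_le_mul_of_nonneg_left (hop.mul_ev_one_le hlam hC k) hε.le
    have hc : 0 < ev lam 1 / C := div_pos h1 (by linarith)
    refine le_of_mul_le_mul_right ?_ hc
    linarith
  · have h2 := mul_le_mul_of_nonneg_left (hop.evMax_le_mul_evMean hlam k) hε.le
    have h3 : ε * evMean lam k ≤ ε * k * evMean lam k := by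
      have := mul_pos hε (evMean_pos hlam k)
      nlinarith
    rw [lt_div_iff₀ (by linarith)] at hb
    nlinarith

theorem kappaStar_mul_le (hlam : ∀ j, lam j ≠ 0) (hγ : ∀ j, 0 < γ j) (hε : ε ∈ Set.Ioo 0 ε₀) :
    kappaStar γ lam ε₀ * minimaxRate γ lam ε ≤
      ε * minimaxDim γ lam ε * evMean lam (minimaxDim γ lam ε) := by
  have hR := minimaxRate_pos (lam := lam) hγ ε
  have h : kappaStar γ lam ε₀ ≤ (minimaxRate γ lam ε)⁻¹ *
      min (γ (minimaxDim γ lam ε)) (ε * minimaxDim γ lam ε * evMean lam (minimaxDim γ lam ε)) := by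
    refine csInf_le ⟨0, ?_⟩ ⟨ε, hε, rfl⟩
    rintro _ ⟨ε', hε', rfl⟩
    refine mul_nonneg (inv_nonneg.2 (minimaxRate_pos hγ ε').le) (le_min (hγ _).le ?_)
    exact mul_nonneg (mul_nonneg hε'.1.le (by positivity)) (evMean_pos hlam _).le
  rw [← div_eq_inv_mul, le_div_iff₀ hR] at h
  exact h.trans (min_le_right _ _)

theorem kappaStar_le_one (hlam : ∀ j, lam j ≠ 0) (hγ : ∀ j, 0 < γ j) (hε₀ : 0 < ε₀) :
    kappaStar γ lam ε₀ ≤ 1 := by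
  have hR := minimaxRate_pos (lam := lam) hγ (ε₀ / 2)
  have h := kappaStar_mul_le (ε := ε₀ / 2) (ε₀ := ε₀) hlam hγ ⟨by linarith, by linarith⟩
  have h2 : _ ≤ minimaxRate γ lam (ε₀ / 2) := le_max_right _ _
  exact le_of_mul_le_mul_right (by linarith [h.trans h2]) hR

/-! ### The ellipsoid and the bias -/

theorem summable_of_mem_ellipsoid (hγ : ∀ j, 0 < γ j) {θ : ℕ+ → ℝ} (hθ : θ ∈ ellipsoid γ μ r) :
    Summable fun j => (θ j - μ j) ^ 2 / γ j := by
  have h := hθ.2.trans_lt ENNReal.ofReal_lt_top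
  unfold weightedNormSq at h
  refine (ENNReal.summable_toReal h.ne).congr fun j => ?_
  have := hγ j
  rw [ENNReal.toReal_ofReal (by positivity)]
  rfl

theorem tsum_le_of_mem_ellipsoid (hγ : ∀ j, 0 < γ j) (hr : 0 ≤ r) {θ : ℕ+ → ℝ}
    (hθ : θ ∈ ellipsoid γ μ r) : ∑' j, (θ j - μ j) ^ 2 / γ j ≤ r := by
  rw [← ENNReal.ofReal_le_ofReal_iff hr, ENNReal.ofReal_tsum_of_nonneg
    (fun j => div_nonneg (sq_nonneg _) (hγ j).le) (summable_of_mem_ellipsoid hγ hθ)]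
  exact hθ.2

theorem sq_le_sq_div (hγ : ∀ j, 0 < γ j) (hγ_anti : Antitone γ) (hγ_one : γ 1 = 1)
    (x : ℕ+ → ℝ) (j : ℕ+) : x j ^ 2 ≤ x j ^ 2 / γ j :=
  le_div_self (sq_nonneg _) (hγ j) (hγ_one ▸ hγ_anti one_le)

theorem summable_sq (hγ : ∀ j, 0 < γ j) (hγ_anti : Antitone γ) (hγ_one : γ 1 = 1)
    {x : ℕ+ → ℝ} (hx : Summable fun j => x j ^ 2 / γ j) : Summable fun j => x j ^ 2 :=
  hx.of_nonneg_of_le (fun _ => sq_nonneg _) (sq_le_sq_div hγ hγ_anti hγ_one x)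

/-- Keeping the tail of the weighted series, not its full sum, shows that for fixed `x` the bias is
`o(γ m)`. -/
theorem bias_le_mul (hγ : ∀ j, 0 < γ j) (hγ_anti : Antitone γ) (hγ_one : γ 1 = 1)
    {x : ℕ+ → ℝ} (hx : Summable fun j => x j ^ 2 / γ j) (m : ℕ+) :
    bias x m ≤ γ m * ∑' j, (Set.Ioi m).indicator (fun j => x j ^ 2 / γ j) j := by
  unfold bias
  rw [← tsum_mul_left]
  refine ((summable_sq hγ hγ_anti hγ_one hx).indicator _).tsum_le_tsum (fun j => ?_)
    ((hx.indicator _).mul_left _)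
  by_cases h : j ∈ Set.Ioi m
  · rw [Set.indicator_of_mem h, Set.indicator_of_mem h, mul_div_assoc', le_div_iff₀ (hγ j),
      mul_comm]
    exact mul_le_mul_of_nonneg_right (hγ_anti (le_of_lt h)) (sq_nonneg _)
  · rw [Set.indicator_of_notMem h, Set.indicator_of_notMem h, mul_zero]

theorem bias_le_mul_tsum (hγ : ∀ j, 0 < γ j) (hγ_anti : Antitone γ) (hγ_one : γ 1 = 1)
    {x : ℕ+ → ℝ} (hx : Summable fun j => x j ^ 2 / γ j) (m : ℕ+) :
    bias x m ≤ γ m * ∑' j, x j ^ 2 / γ j := by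
  refine (bias_le_mul hγ hγ_anti hγ_one hx m).trans
    (mul_le_mul_of_nonneg_left ?_ (hγ m).le)
  exact (hx.indicator _).tsum_le_tsum
    (fun j => Set.indicator_le_self' (fun _ _ => div_nonneg (sq_nonneg _) (hγ _).le) j) hx

theorem tendsto_tsum_indicator_Ioi {f : ℕ+ → ℝ} (hf : Summable f) :
    Tendsto (fun m : ℕ+ => ∑' j, (Set.Ioi m).indicator f j) atTop (𝓝 0) := by
  have := tendsto_tsum_of_dominated_convergence (𝓕 := atTop) (bound := fun j => ‖f j‖)
    (f := fun (m : ℕ+) j => (Set.Ioi m).indicator f j) (g := fun _ => 0) hf.norm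
    (fun j => tendsto_const_nhds.congr' ?_)
    (Eventually.of_forall fun m j => norm_indicator_le_norm_self _ _)
  · simpa using this
  · filter_upwards [eventually_ge_atTop j] with m hm
    rw [Set.indicator_of_notMem (by simpa using hm)]

theorem bias_eq_sum_add {x : ℕ+ → ℝ} (hx : Summable fun j => x j ^ 2) {m k : ℕ+} (h : m ≤ k) :
    bias x m = ∑ j ∈ Finset.Ioc m k, x j ^ 2 + bias x k := by
  unfold bias
  have e : ∀ j, (Set.Ioi m).indicator (fun j => x j ^ 2) j =
      (↑(Finset.Ioc m k) : Set ℕ+).indicator (fun j => x j ^ 2) j +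
        (Set.Ioi k).indicator (fun j => x j ^ 2) j := by
    intro j
    have hd : Disjoint (Set.Ioc m k) (Set.Ioi k) :=
      Set.disjoint_left.2 fun j h1 h2 => absurd h1.2 (not_le.2 h2)
    rw [Finset.coe_Ioc, ← Set.Ioc_union_Ioi_eq_Ioi h, Set.indicator_union_of_disjoint hd]
  simp_rw [e]
  rw [(hx.indicator _).tsum_add (hx.indicator _)]
  congr 1
  rw [tsum_eq_sum (s := Finset.Ioc m k) fun j hj => Set.indicator_of_notMem (by simpa using hj) _]
  exact Finset.sum_congr rfl fun j hj => Set.indicator_of_mem (by exact_mod_cast hj) _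

theorem bias_nonneg (x : ℕ+ → ℝ) (m : ℕ+) : 0 ≤ bias x m :=
  tsum_nonneg fun j => Set.indicator_nonneg (fun _ _ => sq_nonneg _) j

/-! ### The prior variances -/

theorem PriorVarianceCond.pos (hlam : ∀ j, lam j ≠ 0) (hd : 0 < d) (hς : PriorVarianceCond lam ς d)
    (hε : ε ∈ Set.Ioo (0 : ℝ) 1) {j : ℕ+} (hj : j ≤ maxDim lam ε) : 0 < ς j := by
  have h := hς ε hε j hj
  have h1 : 0 < d * (ε * ev lam j) := mul_pos hd (mul_pos hε.1 (ev_pos hlam j))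
  have h2 : d * (ε * ev lam j) ≤ d * max (√ε * √(ev lam j)) (ε * ev lam j) := by
    gcongr; exact le_max_right _ _
  exact_mod_cast h1.trans_le (h2.trans h)

theorem shrink_bounds (hlam : ∀ j, lam j ≠ 0) (hd : 0 < d) (hς : PriorVarianceCond lam ς d)
    (hε : ε ∈ Set.Ioo (0 : ℝ) 1) {j : ℕ+} (hj : j ≤ maxDim lam ε) :
    (1 + 1 / d)⁻¹ ≤ shrink lam ς ε j ∧ shrink lam ς ε j ≤ 1 := by
  have h0 : (0 : ℝ) < ς j := PriorVarianceCond.pos hlam hd hς hε hj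
  have h1 : 0 < ε * ev lam j := mul_pos hε.1 (ev_pos hlam j)
  have h := hς ε hε j hj
  have h2 : d * (ε * ev lam j) ≤ ς j :=
    le_trans (by gcongr; exact le_max_right _ _) h
  unfold shrink
  constructor
  · rw [inv_eq_one_div, div_le_div_iff₀ (by positivity) (by positivity)]
    have : ε * ev lam j ≤ ς j * (1 / d) := by
      rw [mul_one_div, le_div_iff₀ hd]; linarith
    linarith
  · rw [div_le_one (by positivity)]; linarith

/-- The square-root half of the variance condition makes the squared shrinkage bias of the order of
the noise level `ε Λⱼ`; the linear half gives `shrink_bounds`. -/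
theorem one_sub_shrink_sq_le (hlam : ∀ j, lam j ≠ 0) (hd : 0 < d) (hς : PriorVarianceCond lam ς d)
    (hε : ε ∈ Set.Ioo (0 : ℝ) 1) {j : ℕ+} (hj : j ≤ maxDim lam ε) :
    (1 - shrink lam ς ε j) ^ 2 ≤ ε * ev lam j / d ^ 2 := by
  have h0 : (0 : ℝ) < ς j := PriorVarianceCond.pos hlam hd hς hε hj
  have h1 : 0 < ε * ev lam j := mul_pos hε.1 (ev_pos hlam j)
  have h := hς ε hε j hj
  have h2 : d * (√ε * √(ev lam j)) ≤ ς j :=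
    le_trans (by gcongr; exact le_max_left _ _) h
  have h3 : d ^ 2 * (ε * ev lam j) ≤ ς j ^ 2 := by
    have := pow_le_pow_left₀ (by positivity) h2 2
    rwa [mul_pow, mul_pow, Real.sq_sqrt hε.1.le, Real.sq_sqrt (ev_pos hlam j).le] at this
  have e : 1 - shrink lam ς ε j = ε * ev lam j / (ς j + ε * ev lam j) := by
    unfold shrink
    field_simp
    ring
  rw [e, div_pow, div_le_div_iff₀ (by positivity) (by positivity)]
  set v := ε * ev lam j
  have h4 : d ^ 2 * v ≤ (ς j + v) ^ 2 := h3.trans (pow_le_pow_left₀ h0.le (by linarith) 2)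
  nlinarith

end

/-! ### Exponents of order `-k`, and the non-asymptotic bound. -/

section

variable {lam μ γ : ℕ+ → ℝ} {ς : ℕ+ → ℝ≥0} {C L ε ε₀ d r : ℝ}

theorem card_Ioc_cast (m k : ℕ+) (h : m ≤ k) : ((Finset.Ioc m k).card : ℝ) = k - m := by
  have : (Finset.Ioc m k).card = (k : ℕ) - m := by simp
  rw [this, Nat.cast_sub (by exact_mod_cast h)]

theorem sq_div_sqrt (hlam : ∀ j, lam j ≠ 0) (hε : 0 < ε) (x : ℝ) (j : ℕ+) :
    (lam j * x / √ε) ^ 2 = x ^ 2 / (ε * ev lam j) := by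
  have := hlam j
  rw [div_pow, Real.sq_sqrt hε.le, mul_pow]
  unfold ev
  field_simp

/-- The exponent bounding the posterior probability of a dimension `m < k` with large bias. -/
theorem sum_lower_le (hlam : ∀ j, lam j ≠ 0) (hε : 0 < ε) (hC : 1 ≤ C) {q R B : ℝ}
    (hq : 0 < q) {k m : ℕ+} (hmk : m < k) {x : ℕ+ → ℝ} (hx : Summable fun j => x j ^ 2)
    (hW : k * (ε * evMax lam k) ≤ L * R) (hk : bias x k ≤ B * R)
    (hm : (B + 8 * L * C / q) * R < bias x m) :
    ∑ j ∈ Finset.Ioc m k, (3 * C / 2 - q / 4 * (lam j * x j / √ε) ^ 2) ≤ -((k : ℝ) / 8) := by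
  have hk1 : (1 : ℝ) ≤ k := by exact_mod_cast k.pos
  have hW0 : 0 < ε * evMax lam k := mul_pos hε (evMax_pos hlam k)
  have h1 : (∑ j ∈ Finset.Ioc m k, x j ^ 2) / (ε * evMax lam k) ≤
      ∑ j ∈ Finset.Ioc m k, (lam j * x j / √ε) ^ 2 := by
    rw [Finset.sum_div]
    refine Finset.sum_le_sum fun j hj => ?_
    rw [sq_div_sqrt hlam hε]
    have := ev_pos hlam j
    gcongr
    exact ev_le_evMax (Finset.mem_Ioc.1 hj).2
  have h2 := bias_eq_sum_add hx hmk.le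
  -- The excess bias `8LC/q · R` lies between `m` and `k`, and `k ε Λ₍ₖ₎ ≤ L R`. The signal term is
  -- then at least `2Ck`, against a penalty of at most `3Ck/2`.
  have h3 : 8 * C * k / q ≤ (∑ j ∈ Finset.Ioc m k, x j ^ 2) / (ε * evMax lam k) := by
    rw [div_le_div_iff₀ hq hW0]
    have h4 : 8 * L * C / q * R ≤ ∑ j ∈ Finset.Ioc m k, x j ^ 2 := by linarith
    rw [div_mul_eq_mul_div, div_le_iff₀ hq] at h4
    have := mul_le_mul_of_nonneg_left hW (by linarith : 0 ≤ 8 * C)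
    linarith
  rw [Finset.sum_sub_distrib, Finset.sum_const, nsmul_eq_mul, card_Ioc_cast m k hmk.le,
    ← Finset.mul_sum]
  have h5 := mul_le_mul_of_nonneg_left (h3.trans h1) (by positivity : 0 ≤ q / 4)
  rw [show q / 4 * (8 * C * k / q) = 2 * C * k by field_simp; norm_num] at h5
  have h6 : (0 : ℝ) ≤ m := by positivity
  nlinarith

/-- The exponent bounding the posterior probability of a dimension `m > D k`. -/
theorem sum_upper_le (hlam : ∀ j, lam j ≠ 0) (hop : OperatorCond lam C L) (hε : 0 < ε)
    (hC : 1 ≤ C) {κ ρ R : ℝ} (hκ : 0 < κ) (hρ : 0 ≤ ρ) {D : ℕ+} (hD : 2 ≤ (D : ℝ))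
    (hρD : 4 * ρ ≤ κ * (D - 1)) {k m : ℕ+} (hkm : D * k < m) {x : ℕ+ → ℝ}
    (hx : Summable fun j => x j ^ 2) (hS : κ * R ≤ k * (ε * evMax lam k))
    (hk : bias x k ≤ ρ * R) :
    ∑ j ∈ Finset.Ioc k m, ((lam j * x j / √ε) ^ 2 / 2 - C / 4) ≤ -((k : ℝ) / 8) := by
  have hk1 : (1 : ℝ) ≤ k := by exact_mod_cast k.pos
  have hW0 : 0 < ε * evMax lam k := mul_pos hε (evMax_pos hlam k)
  have hm : (D : ℝ) * k < m := by exact_mod_cast hkm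
  have hkm' : k ≤ m := by
    have : (k : ℝ) ≤ m := by nlinarith
    exact_mod_cast this
  have h1 : ∑ j ∈ Finset.Ioc k m, (lam j * x j / √ε) ^ 2 ≤
      C * (∑ j ∈ Finset.Ioc k m, x j ^ 2) / (ε * evMax lam k) := by
    rw [Finset.mul_sum, Finset.sum_div]
    refine Finset.sum_le_sum fun j hj => ?_
    rw [div_pow, Real.sq_sqrt hε.le, mul_pow, div_le_div_iff₀ hε hW0]
    have := hop.sq_mul_evMax_le hlam (Finset.mem_Ioc.1 hj).1
    have := mul_le_mul_of_nonneg_right this (mul_nonneg (sq_nonneg (x j)) hε.le)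
    linarith
  have h2 := bias_eq_sum_add hx hkm'
  have h2' := bias_nonneg x m
  have h2'' : bias x m + ∑ j ∈ Finset.Ioc k m, x j ^ 2 = bias x k := by linarith
  -- Halved, the signal is at most `C(D-1)k/8`, while the penalty over more than `(D-1)k`
  -- coordinates is at least `C(D-1)k/4`.
  have h3 : C * (∑ j ∈ Finset.Ioc k m, x j ^ 2) / (ε * evMax lam k) ≤ C * (D - 1) * k / 4 := by
    rw [div_le_iff₀ hW0]
    have h4 : ∑ j ∈ Finset.Ioc k m, x j ^ 2 ≤ ρ * R := by linarith
    have h5 : ρ * R ≤ (D - 1) * k / 4 * (ε * evMax lam k) := by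
      refine le_of_mul_le_mul_left ?_ hκ
      calc κ * (ρ * R) = ρ * (κ * R) := by ring
        _ ≤ ρ * (k * (ε * evMax lam k)) := by gcongr
        _ = 4 * ρ * (k * (ε * evMax lam k) / 4) := by ring
        _ ≤ κ * (D - 1) * (k * (ε * evMax lam k) / 4) := by gcongr
        _ = _ := by ring
    calc C * ∑ j ∈ Finset.Ioc k m, x j ^ 2 ≤ C * ((D - 1) * k / 4 * (ε * evMax lam k)) := by
          gcongr; exact h4.trans h5
      _ = _ := by ring
  rw [Finset.sum_sub_distrib, Finset.sum_const, nsmul_eq_mul, card_Ioc_cast k m hkm',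
    ← Finset.sum_div]
  have h6 : C * (D * k - k) ≤ C * (m - k) := by gcongr
  have h7 : (k : ℝ) ≤ C * ((D - 1) * k) := by
    calc (k : ℝ) = 1 * (1 * k) := by ring
      _ ≤ C * ((D - 1) * k) := by gcongr; linarith
  linarith [h1.trans h3]

/-- The exponent in the Chernoff bound for the squared error of a posterior draw. -/
theorem sum_draw_le (hlam : ∀ j, lam j ≠ 0) (hd : 0 < d) (hς : PriorVarianceCond lam ς d)
    (hε : ε ∈ Set.Ioo (0 : ℝ) 1) {n N : ℕ+} (hnG : n ≤ maxDim lam ε) (hnN : n ≤ N) {V : ℝ}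
    (hV : 0 < V) (hΛ : ∀ j ≤ n, ε * ev lam j ≤ V) {θ : ℕ+ → ℝ}
    (hθ : Summable fun j => (θ j - μ j) ^ 2) (hθr : ∑' j, (θ j - μ j) ^ 2 ≤ r) :
    -(8 * N * V / (8 * V)) + ∑ j ∈ Finset.Icc 1 n,
      (3 / 4 + ((1 - shrink lam ς ε j) * (θ j - μ j)) ^ 2 / (2 * V)) ≤
      -(N / 4) + r / (2 * d ^ 2) := by
  rw [Finset.sum_add_distrib, Finset.sum_const, nsmul_eq_mul]
  have hc : ((Finset.Icc 1 n).card : ℝ) ≤ N := by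
    have : (Finset.Icc 1 n).card = (n : ℕ) := by simp
    rw [this]; exact_mod_cast hnN
  have h1 : ∑ j ∈ Finset.Icc 1 n, ((1 - shrink lam ς ε j) * (θ j - μ j)) ^ 2 / (2 * V) ≤
      ∑ j ∈ Finset.Icc 1 n, (θ j - μ j) ^ 2 / (2 * d ^ 2) := by
    refine Finset.sum_le_sum fun j hj => ?_
    have hj := (Finset.mem_Icc.1 hj).2
    have h2 := (one_sub_shrink_sq_le hlam hd hς hε (hj.trans hnG)).trans
      (div_le_div_of_nonneg_right (hΛ j hj) (by positivity))
    rw [mul_pow, div_le_div_iff₀ (by positivity) (by positivity)]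
    rw [le_div_iff₀ (by positivity)] at h2
    have := mul_le_mul_of_nonneg_right h2 (sq_nonneg (θ j - μ j))
    linarith
  rw [← Finset.sum_div (f := fun j => (θ j - μ j) ^ 2)] at h1
  have h3 : (∑ j ∈ Finset.Icc 1 n, (θ j - μ j) ^ 2) / (2 * d ^ 2) ≤ r / (2 * d ^ 2) := by
    gcongr
    exact (hθ.sum_le_tsum _ fun _ _ => sq_nonneg _).trans hθr
  -- The level `8NV` contributes `-N` to the exponent, of which the Gaussian terms use up at most
  -- `3N/4`.
  have h4 : 8 * N * V / (8 * V) = N := by field_simp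
  rw [h4]
  linarith

/-- The bound for the expected posterior mass outside a ball with radius of the minimax order. -/
def errorBound (lam γ : ℕ+ → ℝ) (d r ε : ℝ) : ℝ≥0∞ :=
  (maxDim lam ε : ℕ) * ENNReal.ofReal (Real.exp (-(minimaxDim γ lam ε / 8))) +
    ENNReal.ofReal (Real.exp (-(minimaxDim γ lam ε / 4) + r / (2 * d ^ 2)))

/-- The number of dimensions is absorbed by writing `G_ε exp(-k/8) = exp((log G_ε / k - 1/8) k)`. -/
theorem tendsto_errorBound (d r : ℝ)
    (hm : Tendsto (minimaxDim γ lam) (𝓝[>] 0) atTop)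
    (hdim : Tendsto (fun ε => Real.log (maxDim lam ε) / (minimaxDim γ lam ε : ℝ))
      (𝓝[>] 0) (𝓝 0)) :
    Tendsto (errorBound lam γ d r) (𝓝[>] 0) (𝓝 0) := by
  have hm' := tendsto_pnat_cast_atTop.comp hm
  have h1 : Tendsto (fun ε => ENNReal.ofReal (Real.exp (-(minimaxDim γ lam ε / 4) +
      r / (2 * d ^ 2)))) (𝓝[>] 0) (𝓝 0) := by
    have : Tendsto (fun ε => -((minimaxDim γ lam ε : ℝ) / 4) + r / (2 * d ^ 2)) (𝓝[>] 0) atBot :=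
      tendsto_atBot_add_const_right _ _
        (tendsto_neg_atTop_atBot.comp (hm'.atTop_div_const (by norm_num)))
    have := ENNReal.tendsto_ofReal (Real.tendsto_exp_atBot.comp this)
    rwa [ENNReal.ofReal_zero] at this
  have h2 : Tendsto (fun ε => (maxDim lam ε : ℕ) *
      ENNReal.ofReal (Real.exp (-(minimaxDim γ lam ε / 8)))) (𝓝[>] 0) (𝓝 0) := by
    have e : ∀ ε, ((maxDim lam ε : ℕ) : ℝ≥0∞) *
        ENNReal.ofReal (Real.exp (-(minimaxDim γ lam ε / 8))) =
        ENNReal.ofReal (Real.exp ((Real.log (maxDim lam ε) / (minimaxDim γ lam ε : ℝ) + -(1 / 8)) *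
          (minimaxDim γ lam ε : ℝ))) := by
      intro ε
      have h0 : (0 : ℝ) < minimaxDim γ lam ε := by exact_mod_cast (minimaxDim γ lam ε).pos
      have h3 : (0 : ℝ) < maxDim lam ε := by exact_mod_cast (maxDim lam ε).pos
      rw [show (Real.log (maxDim lam ε) / (minimaxDim γ lam ε : ℝ) + -(1 / 8)) *
          (minimaxDim γ lam ε : ℝ) = Real.log (maxDim lam ε) + -(minimaxDim γ lam ε / 8) by
          field_simp, Real.exp_add, Real.exp_log h3, ENNReal.ofReal_mul h3.le,
        ENNReal.ofReal_natCast]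
    simp_rw [e]
    have h4 := (hdim.add_const (-(1 / 8))).neg_mul_atTop (by norm_num) hm'
    have := ENNReal.tendsto_ofReal (Real.tendsto_exp_atBot.comp h4)
    rwa [ENNReal.ofReal_zero] at this
  have := h2.add h1
  rwa [add_zero] at this

/-- The core estimate at fixed `ε`. The condition `4ρ ≤ κ*(D - 1)` states how far beyond `k` one
must go before the penalty dominates a signal of size `ρ R`. -/
theorem one_le_expectedPostMass_add
    (hlam : ∀ j, lam j ≠ 0) (hγ_pos : ∀ j, 0 < γ j) (hγ_anti : Antitone γ) (hγ_one : γ 1 = 1)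
    (hr : 0 ≤ r) (hd : 0 < d) (hς : PriorVarianceCond lam ς d)
    (hκ : 0 < kappaStar γ lam ε₀) (hC : 1 ≤ C) (hL : 1 ≤ L) (hop : OperatorCond lam C L)
    (hε : ε ∈ Set.Ioo (0 : ℝ) 1) (hεε₀ : ε < ε₀)
    (hG : minimaxDim γ lam ε ≤ maxDim lam ε) {D : ℕ+} (hD : 2 ≤ (D : ℝ)) {ρ : ℝ} (hρ : 0 ≤ ρ)
    (hρD : 4 * ρ ≤ kappaStar γ lam ε₀ * (D - 1)) {K : ℝ}
    (hK : r + 8 * L * C * (1 + 1 / d) + 8 * (D * evMax lam D) * L ≤ K)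
    {θ : ℕ+ → ℝ} (hθ : θ ∈ ellipsoid γ μ r)
    (hbias : bias (fun j => θ j - μ j) (minimaxDim γ lam ε) ≤ ρ * γ (minimaxDim γ lam ε)) :
    1 ≤ expectedPostMass lam μ ς C ε θ (K * minimaxRate γ lam ε) + errorBound lam γ d r ε := by
  have hε0 := hε.1
  set k := minimaxDim γ lam ε with hkdef
  set R := minimaxRate γ lam ε with hRdef
  have hR : 0 < R := minimaxRate_pos hγ_pos ε
  have hk1 : (1 : ℝ) ≤ k := by exact_mod_cast k.pos
  have hγR : γ k ≤ R := le_max_left _ _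
  have hSR : ε * k * evMean lam k ≤ R := le_max_right _ _
  have hW : k * (ε * evMax lam k) ≤ L * R := by
    have h1 := mul_le_mul_of_nonneg_left (hop.evMax_le_mul_evMean hlam k)
      (by positivity : 0 ≤ ε * k)
    have h2 := mul_le_mul_of_nonneg_left hSR (by linarith : 0 ≤ L)
    linarith
  have hS : kappaStar γ lam ε₀ * R ≤ k * (ε * evMax lam k) := by
    have h1 := kappaStar_mul_le hlam hγ_pos (ε₀ := ε₀) ⟨hε0, hεε₀⟩
    have h2 := mul_le_mul_of_nonneg_left (hop.evMean_le_evMax hlam k)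
      (by positivity : 0 ≤ ε * k)
    linarith
  have hsγ := summable_of_mem_ellipsoid hγ_pos hθ
  have htγ := tsum_le_of_mem_ellipsoid hγ_pos hr hθ
  have hs : Summable fun j => (θ j - μ j) ^ 2 :=
    summable_sq hγ_pos hγ_anti hγ_one (x := fun j => θ j - μ j) hsγ
  have hts : ∑' j, (θ j - μ j) ^ 2 ≤ r :=
    (hs.tsum_le_tsum (sq_le_sq_div hγ_pos hγ_anti hγ_one fun j => θ j - μ j) hsγ).trans htγ
  have hb1 : bias (fun j => θ j - μ j) k ≤ r * R := by
    calc _ ≤ γ k * ∑' j, (θ j - μ j) ^ 2 / γ j :=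
          bias_le_mul_tsum hγ_pos hγ_anti hγ_one (x := fun j => θ j - μ j) hsγ k
      _ ≤ R * r := mul_le_mul hγR htγ
          (tsum_nonneg fun j => div_nonneg (sq_nonneg _) (hγ_pos j).le) hR.le
      _ = _ := mul_comm _ _
  have hb2 : bias (fun j => θ j - μ j) k ≤ ρ * R := hbias.trans (by gcongr)
  have hslam : Summable fun j => (lam j * (θ j - μ j)) ^ 2 := by
    refine (hs.mul_left (C * lam 1 ^ 2)).of_nonneg_of_le (fun _ => sq_nonneg _) fun j => ?_
    rw [mul_pow]
    refine mul_le_mul_of_nonneg_right ?_ (sq_nonneg _)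
    rcases (one_le : (1 : ℕ+) ≤ j).eq_or_lt with h | h
    · rw [← h]; exact le_mul_of_one_le_left (sq_nonneg _) hC
    · exact hop.tail_le 1 j 1 h le_rfl
  set q := (1 + 1 / d)⁻¹ with hqdef
  have hq : 0 < q := by positivity
  have hqC : 8 * L * C * (1 + 1 / d) = 8 * L * C / q := by rw [hqdef, div_inv_eq_mul]
  set N : ℕ+ := D * k with hN
  have hNr : (N : ℝ) = D * k := by rw [hN]; push_cast; ring
  set V := ε * evMax lam N with hVdef
  have hV : 0 < V := mul_pos hε0 (evMax_pos hlam N)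
  -- The shrinkage factors are controlled only up to `G_ε`, whereas `D k` may exceed it.
  set n := min N (maxDim lam ε) with hn
  have hnN : n ≤ N := min_le_left _ _
  have hnG : n ≤ maxDim lam ε := min_le_right _ _
  have hΛ : ∀ j ≤ n, ε * ev lam j ≤ V := fun j hj =>
    mul_le_mul_of_nonneg_left (ev_le_evMax (hj.trans hnN)) hε0.le
  -- Submultiplicativity separates the factor depending on `D` from the variance at `k`.
  have hNV : N * V ≤ D * evMax lam D * L * R := by
    have h1 := hop.evMax_mul_le D k
    have hDpos := evMax_pos hlam D
    calc N * V ≤ (D * k) * (ε * (evMax lam D * evMax lam k)) := by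
          rw [hNr, hVdef]; gcongr
      _ = D * evMax lam D * (k * (ε * evMax lam k)) := by ring
      _ ≤ D * evMax lam D * (L * R) := by gcongr
      _ = _ := by ring
  refine le_expectedPostMass (n := n) (t' := 8 * N * V) (β := (r + 8 * L * C / q) * R)
    hε0 hlam (fun j hj => PriorVarianceCond.pos hlam hd hς hε hj) hslam hs ?_ (fun m hm => ?_) ?_
  · have := mul_le_mul_of_nonneg_right hK hR.le
    rw [hqC] at this
    linarith
  · by_cases hlo : m < k ∧ (r + 8 * L * C / q) * R < bias (fun j => θ j - μ j) m
    · left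
      refine (lintegral_dimPost_le_of_lt hε0 hG hlo.1 hq.le fun j hj =>
        shrink_bounds hlam hd hς hε (hj.trans hG)).trans (ENNReal.ofReal_le_ofReal
        (Real.exp_le_exp.2 ?_))
      exact sum_lower_le (x := fun j => θ j - μ j) hlam hε0 hC hq hlo.1 hs hW hb1 hlo.2
    by_cases hhi : N < m
    · left
      have hkm : k < m := lt_of_le_of_lt (by
        rw [hN]; exact le_mul_of_one_le_left' one_le) hhi
      refine (lintegral_dimPost_le_of_gt hε0 hC hm hkm fun j hj =>
        (shrink_bounds hlam hd hς hε (hj.trans hm)).2).trans (ENNReal.ofReal_le_ofReal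
        (Real.exp_le_exp.2 ?_))
      exact sum_upper_le (x := fun j => θ j - μ j) hlam hop hε0 hC hκ hρ hD hρD hhi hs hS hb2
    · right
      refine ⟨le_min (not_lt.1 hhi) hm, ?_⟩
      by_cases hmk : m < k
      · exact not_lt.1 fun h => hlo ⟨hmk, h⟩
      · have h1 := bias_eq_sum_add (x := fun j => θ j - μ j) hs (not_lt.1 hmk)
        have h2 : 0 ≤ ∑ j ∈ Finset.Ioc k m, (θ j - μ j) ^ 2 :=
          Finset.sum_nonneg fun j _ => sq_nonneg _
        have h3 : 0 ≤ 8 * L * C / q * R := by positivity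
        linarith
  · refine (lintegral_noise_drawError_le hε0 hlam _ hV hΛ fun j hj => ?_).trans
      (ENNReal.ofReal_le_ofReal (Real.exp_le_exp.2 ?_))
    · have := shrink_bounds hlam hd hς hε (hj.trans hnG)
      exact ⟨hq.le.trans this.1, this.2⟩
    · refine (sum_draw_le hlam hd hς hε hnG hnN hV hΛ hs hts).trans ?_
      have : (k : ℝ) ≤ N := by rw [hNr]; nlinarith
      linarith

theorem expectedPostMass_le_one (θ : ℕ+ → ℝ) (t : ℝ) :
    expectedPostMass lam μ ς C ε θ t ≤ 1 := by
  unfold expectedPostMass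
  refine (lintegral_mono fun y => prob_le_one).trans ?_
  simp

theorem le_DStar {κ : ℝ} (hκ : 0 < κ) (hL : 0 < L) : 5 * L / κ ≤ DStar L κ := by
  have h : 0 < ⌈5 * L / κ⌉₊ := Nat.ceil_pos.2 (by positivity)
  have : ((DStar L κ : ℕ+) : ℕ) = ⌈5 * L / κ⌉₊ := by
    unfold DStar
    rw [Nat.toPNat'_coe, if_pos h]
  rw [this]
  exact Nat.le_ceil _

/-- With `K* = 16 T`, the three summands are at most `T`, `T` and `8T`. -/
theorem le_KStar (hlam : ∀ j, lam j ≠ 0) (hd : 0 < d) (hr : 0 ≤ r) (hC : 1 ≤ C) (hL : 1 ≤ L)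
    (κ : ℝ) :
    r + 8 * L * C * (1 + 1 / d) + 8 * (DStar L κ * evMax lam (DStar L κ)) * L ≤
      KStar lam d r C L κ := by
  have hD : 0 < (DStar L κ : ℝ) * evMax lam (DStar L κ) :=
    mul_pos (by exact_mod_cast (DStar L κ).pos) (evMax_pos hlam _)
  unfold KStar
  set B := (DStar L κ : ℝ) * evMax lam (DStar L κ)
  set a := 1 + 1 / d with ha
  have ha1 : 1 ≤ a := by rw [ha]; linarith [one_div_pos.2 hd]
  set X := max a (r / d ^ 2)
  have hX : 1 ≤ X := ha1.trans (le_max_left _ _)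
  set Y := max (8 * C * a) B
  have hY1 : 8 * C * a ≤ Y := le_max_left _ _
  have hY2 : B ≤ Y := le_max_right _ _
  set Z := max 1 r
  have hZ1 : 1 ≤ Z := le_max_left _ _
  have hZ2 : r ≤ Z := le_max_right _ _
  have hCa : 1 ≤ C * a := one_le_mul_of_one_le_of_one_le hC ha1
  have hY : 1 ≤ Y := by linarith
  have hY0 : 0 ≤ Y := by linarith
  have hL2 : L ≤ L ^ 2 := by nlinarith
  have h0 : L * Y ≤ X * L ^ 2 * Y * Z := by
    calc L * Y = 1 * L * Y * 1 := by ring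
      _ ≤ X * L ^ 2 * Y * Z := by gcongr
  have h1 : r ≤ X * L ^ 2 * Y * Z := by
    calc r = 1 * 1 ^ 2 * 1 * r := by ring
      _ ≤ X * L ^ 2 * Y * Z := by gcongr
  have h2 : L * (8 * C * a) ≤ L * Y := by gcongr
  have h3 : L * B ≤ L * Y := by gcongr
  have h4 : 0 ≤ L * Y := by positivity
  linarith

end

end SieveGSSM

end

theorem mainTheorem2
    (lam μ γ : ℕ+ → ℝ) (ς : ℕ+ → ℝ≥0) (r d C L ε₀ : ℝ)
    (hlam : ∀ j, lam j ≠ 0)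
    (hγ_pos : ∀ j, 0 < γ j) (hγ_anti : Antitone γ) (hγ_one : γ 1 = 1)
    (hγ_lim : Tendsto γ atTop (𝓝 0))
    (hr : 0 ≤ r) (hne : (ellipsoid γ μ r).Nonempty)
    (hd : 0 < d) (hς : PriorVarianceCond lam ς d)
    (hε₀ : 0 < ε₀) (hκ : 0 < kappaStar γ lam ε₀)
    (hC : 1 ≤ C) (hL : 1 ≤ L) (hop : OperatorCond lam C L)
    (hdim : Tendsto (fun ε => Real.log (maxDim lam ε) / (minimaxDim γ lam ε : ℝ))
      (𝓝[>] 0) (𝓝 0)) :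
    (∀ θ₀ ∈ ellipsoid γ μ r,
      Tendsto (fun ε => expectedPostMass lam μ ς C ε θ₀
          (KStar lam d r C L (kappaStar γ lam ε₀) * minimaxRate γ lam ε))
        (𝓝[>] 0) (𝓝 1)) ∧
    (∀ K : ℝ → ℝ, AntitoneOn K (Set.Ioo 0 1) → ¬ BddAbove (K '' Set.Ioo 0 1) →
      Tendsto (fun ε => ⨅ θ₀ ∈ ellipsoid γ μ r,
          expectedPostMass lam μ ς C ε θ₀ (K ε * minimaxRate γ lam ε))
        (𝓝[>] 0) (𝓝 1)) := by
  have hm := tendsto_minimaxDim hlam hop hC hγ_pos hγ_anti hγ_lim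
  have hG := eventually_minimaxDim_le_maxDim hlam hop hC hL hγ_pos hγ_lim
  have hlow : Tendsto (fun ε => 1 - errorBound lam γ d r ε) (𝓝[>] 0) (𝓝 1) := by
    have := ENNReal.Tendsto.sub tendsto_const_nhds (tendsto_errorBound (lam := lam) (γ := γ)
      d r hm hdim) (Or.inl (ENNReal.one_ne_top))
    rwa [tsub_zero] at this
  have hsmall : ∀ b : ℝ, 0 < b → ∀ᶠ ε in 𝓝[>] (0 : ℝ), ε ∈ Set.Ioo 0 b := fun b hb =>
    Ioo_mem_nhdsGT hb
  refine ⟨fun θ hθ => ?_, fun K hK hKb => ?_⟩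
  · refine tendsto_of_tendsto_of_tendsto_of_le_of_le' hlow tendsto_const_nhds ?_
      (Eventually.of_forall fun ε => expectedPostMass_le_one θ _)
    have hD := le_DStar hκ (by linarith : 0 < L)
    -- With `ρ = κ*` the condition on `D` reads `4 ≤ D - 1`; it holds because `L ≥ 1` and `κ* ≤ 1`.
    have hD5 : 5 ≤ (DStar L (kappaStar γ lam ε₀) : ℝ) := by
      refine le_trans ?_ hD
      rw [le_div_iff₀ hκ]
      linarith [kappaStar_le_one hlam hγ_pos (γ := γ) hε₀]
    have hsγ := summable_of_mem_ellipsoid hγ_pos hθ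
    -- For this fixed `θ`, the weighted tail beyond `k` eventually falls below `κ*`. This is the
    -- only step that is not uniform over the ellipsoid.
    filter_upwards [hG, hsmall 1 one_pos, hsmall ε₀ hε₀,
      ((tendsto_tsum_indicator_Ioi hsγ).comp hm).eventually_le_const hκ] with ε h1 h2 h3 h4
    rw [tsub_le_iff_right]
    refine one_le_expectedPostMass_add hlam hγ_pos hγ_anti hγ_one hr hd hς hκ hC hL hop h2 h3.2 h1
      (D := DStar L (kappaStar γ lam ε₀)) (by linarith) hκ.le (by nlinarith)
      (le_KStar hlam hd hr hC hL _) hθ ?_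
    refine (bias_le_mul hγ_pos hγ_anti hγ_one (x := fun j => θ j - μ j) hsγ _).trans ?_
    rw [mul_comm]
    exact mul_le_mul_of_nonneg_right h4 (hγ_pos _).le
  -- Uniformly, `ρ = r`, which requires `4r ≤ κ*(D - 1)`.
  · obtain ⟨D, hD⟩ : ∃ D : ℕ+, 2 + 4 * r / kappaStar γ lam ε₀ ≤ (D : ℝ) :=
      (tendsto_pnat_cast_atTop.eventually_ge_atTop _).exists
    have h0 : 0 ≤ 4 * r / kappaStar γ lam ε₀ := by positivity
    set K₀ := r + 8 * L * C * (1 + 1 / d) + 8 * (D * evMax lam D) * L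
    -- Unboundedness gives one `ε₁` at which `K` exceeds the constant; monotonicity extends this to
    -- all smaller `ε`.
    obtain ⟨ε₁, hε₁, hKε₁⟩ : ∃ ε₁ ∈ Set.Ioo (0 : ℝ) 1, K₀ < K ε₁ := by
      by_contra! h
      exact hKb ⟨K₀, by rintro _ ⟨ε, hε, rfl⟩; exact h ε hε⟩
    refine tendsto_of_tendsto_of_tendsto_of_le_of_le' hlow tendsto_const_nhds ?_
      (Eventually.of_forall fun ε => ?_)
    · filter_upwards [hG, hsmall 1 one_pos, hsmall ε₀ hε₀, hsmall ε₁ hε₁.1] with ε h1 h2 h3 h4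
      refine le_iInf₂ fun θ hθ => ?_
      rw [tsub_le_iff_right]
      have hsγ := summable_of_mem_ellipsoid hγ_pos hθ
      refine one_le_expectedPostMass_add hlam hγ_pos hγ_anti hγ_one hr hd hς hκ hC hL hop h2 h3.2
        h1 (D := D) (by linarith) hr ?_ (hKε₁.le.trans (hK h2 hε₁ h4.2.le)) hθ ?_
      · have : 4 * r / kappaStar γ lam ε₀ ≤ D - 1 := by linarith
        rw [div_le_iff₀ hκ] at this
        linarith
      · refine (bias_le_mul_tsum hγ_pos hγ_anti hγ_one (x := fun j => θ j - μ j) hsγ _).trans ?_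
        rw [mul_comm]
        exact mul_le_mul_of_nonneg_right (tsum_le_of_mem_ellipsoid hγ_pos hr hθ) (hγ_pos _).le
    -- Over an empty ellipsoid the infimum would be `∞`.
    · obtain ⟨θ, hθ⟩ := hne
      exact (iInf₂_le θ hθ).trans (expectedPostMass_le_one θ _)
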